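/- **Model.** A radio network is a finite graph, directed or undirected (an undirected graph is a directed graph with symmetric edge relation), with $n$ nodes and a source $s$ from which every node is reachable; $D$ is the eccentricity of the source, i.e. the largest distance from $s$ to a node. Time is divided into synchronous steps. In each step every node either transmits a message or listens, and a listening node hears a message if and only if exactly one of its in-neighbours transmits; without collision detection, a listening node cannot distinguish between none and several of its in-neighbours transmitting, and a transmitting node hears nothing. Initially only $s$ knows the source message; all other nodes are inactive (do not transmit) until they hear a transmission. The network is blind: all nodes run the same randomized local algorithm, which is fixed before the network is given and has no information about the graph, $n$ or $D$ (a node knows only whether it is the source; nodes need no identifiers and no global clock). Write $\log x=\max\{\log_2x,1\}$. **Algorithm.** For $t=1,2,3,\dots$ perform an iteration of length $T=2^t$: the source draws independent uniform $S_1,\dots,S_T\in\{1,2\}$ and, independently for each $j\in\{1,\dots,T\}$ given $S_j$, a value $x_j\in\mathbb N\cup\{0\}$ from the distribution $Y_{S_j,T}$, and appends these, and the current step number, to the source message. In step $j$ of the iteration every active node, independently of the others, transmits what it holds with probability $2^{-x_j}$, and listens otherwise. The source is always active; another node becomes active when it hears a transmission, and becomes inactive again at the end of the iteration. Here, for a constant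 $c_1>0$, * (Shallow-Broadcast) $Y_{1,T}$ takes each integer value $y$ with $1\le y\le \sqrt T/c_1$ with probability $c_1/\sqrt T$, and the value $0$ with the remaining probability; * (General-Broadcast) $Y_{2,T}$ takes each integer value $y\ge1$ with probability $\frac1{3y\log^2y}$, and the value $0$ with the remaining probability. **Theorem.** There are constants $c_1,K,c>0$ and $n_0$ such that in every radio network without collision detection, directed or undirected, with $n\ge n_0$ nodes, a source from which all nodes are reachable, and source eccentricity $D$, the algorithm above performs broadcasting in $O\left(D\log\frac nD\,\log^2\log\frac nD+\log^2n\right)$ time with high probability: for every integer $$\tau\ \ge\ K\left(D\log\tfrac nD\,\bigl(\log\log\tfrac nD\bigr)^2+\log^2n\right),$$ the probability that some node does not know the source message after $\tau$ time-steps is at most $n^{-c}$. -/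

import Mathlib

open scoped NNReal ENNReal

noncomputable section

namespace RadioNetwork

/-! ### Probability mass functions -/

lemma tsum_prod_fin {α : Type*} (n : ℕ) (p : Fin n → α → ℝ≥0∞) :
    ∑' f : Fin n → α, ∏ i, p i (f i) = ∏ i, ∑' a, p i a := by
  induction n with
  | zero => simp [tsum_fintype]
  | succ n ih =>
    rw [← (Fin.consEquiv (fun _ : Fin (n + 1) => α)).tsum_eq,
      ENNReal.tsum_prod' (f := fun c => ∏ i, p i (Fin.consEquiv (fun _ : Fin (n + 1) => α) c i))]
    simp only [Fin.consEquiv, Equiv.coe_fn_mk, Fin.prod_univ_succ, Fin.cons_zero, Fin.cons_succ,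
      ENNReal.tsum_mul_left, ENNReal.tsum_mul_right, ih]

lemma tsum_prod_pi {ι α : Type*} [Fintype ι] (p : ι → α → ℝ≥0∞) :
    ∑' f : ι → α, ∏ i, p i (f i) = ∏ i, ∑' a, p i a := by
  let e := Fintype.equivFin ι
  rw [← (e.symm.prod_comp fun i => ∑' a, p i a), ← tsum_prod_fin,
    ← (e.arrowCongr (Equiv.refl α)).tsum_eq]
  refine tsum_congr fun f => ?_
  rw [← e.symm.prod_comp]
  simp [Equiv.arrowCongr]

/-- The joint law of independent random variables, the `i`-th of which has law `p i`. -/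
def independent {ι α : Type*} [Fintype ι] (p : ι → PMF α) : PMF (ι → α) :=
  ⟨fun f => ∏ i, p i (f i), by
    rw [Summable.hasSum_iff ENNReal.summable, tsum_prod_pi]
    simp [PMF.tsum_coe]⟩

/-- The law of a list of `k` independent samples of `p`. -/
def samples {α : Type*} (p : PMF α) : ℕ → PMF (List α)
  | 0 => PMF.pure []
  | k + 1 => p.bind fun a => (samples p k).map (a :: ·)

/-- The law on `ℕ` that takes each value `y ≥ 1` with probability `f y`, and the value `0` with
the remaining probability. -/
def withRemainder (f : ℕ → ℝ≥0∞) (hf : ∑' y, f (y + 1) ≤ 1) : PMF ℕ :=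
  ⟨fun y => if y = 0 then 1 - ∑' z, f (z + 1) else f y, by
    rw [Summable.hasSum_iff ENNReal.summable, tsum_eq_zero_add' ENNReal.summable]
    simpa using tsub_add_cancel_of_le hf⟩

/-- A coin that shows `true` with probability `p`. -/
def coin (p : ℝ≥0) (hp : p ≤ 1) : PMF Bool :=
  PMF.ofFintype (fun b => if b then (p : ℝ≥0∞) else ((1 - p : ℝ≥0) : ℝ≥0∞)) (by
    rw [Fintype.sum_bool, if_pos rfl, if_neg (by decide)]
    exact_mod_cast add_tsub_cancel_of_le hp)

/-! ### Networks

A network is a directed graph `G : Digraph V` on a finite type of nodes: `G.Adj u v` means that `u`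
can reach `v` by direct transmission. Undirected networks are those with a symmetric `G.Adj`. -/

/-- `Steps G k u v`: there is a directed walk with exactly `k` edges from `u` to `v`. -/
def Steps {V : Type} (G : Digraph V) : ℕ → V → V → Prop
  | 0, u, v => u = v
  | k + 1, u, v => ∃ w, Steps G k u w ∧ G.Adj w v

/-- Every node can be reached from `s` by a directed walk. -/
def AllReachable {V : Type} (G : Digraph V) (s : V) : Prop :=
  ∀ v, ∃ k, Steps G k s v

/-- The number of edges of a shortest directed walk from `u` to `v`. -/
def dist {V : Type} (G : Digraph V) (u v : V) : ℕ :=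
  sInf {k | Steps G k u v}

/-- The eccentricity of `s`: the largest distance from `s` to a node. -/
def eccentricity {V : Type} [Fintype V] (G : Digraph V) (s : V) : ℕ :=
  Finset.univ.sup fun v => dist G s v

open Classical in
/-- What node `v` hears in a time-step in which node `u` transmits `tx u` (`none` if `u` listens).
A listening node hears a message iff exactly one of its in-neighbours transmits; there is no
collision detection, so the outcomes "no in-neighbour transmits" and "several in-neighbours
transmit" are both `none`. A transmitting node hears nothing. -/
def heard {V Msg : Type} (G : Digraph V) (tx : V → Option Msg) (v : V) : Option Msg :=
  if h : tx v = none ∧ ∃! u, G.Adj u v ∧ (tx u).isSome then tx h.2.choose else none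

/-! ### Distributed randomized broadcasting algorithms without network knowledge

The algorithm is the same at all nodes (except that the source knows that it is the source and
holds the source message), it is fixed before the network, and a node's behaviour depends only on
its own state, that is, on its own random choices and on what it has heard. -/

/-- A blind randomized broadcasting algorithm, for source messages of type `M`. -/
structure BlindAlgorithm (M : Type) where
  /-- Local states of a node. -/
  State : Type
  /-- The messages that can be transmitted. -/
  Msg : Type
  /-- The initial state of the source, given the source message. -/
  start : M → State
  /-- The initial, inactive, state of all other nodes. -/
  idle : State
  /-- First half of a time-step: the node makes its random choices, updates its state, and either
  transmits a message or listens (`none`). -/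
  act : State → PMF (State × Option Msg)
  /-- Second half of a time-step: the node updates its state according to what it has heard. -/
  hear : State → Option Msg → State
  /-- The source message, once it is known to the node. -/
  learned : State → Option M
  /-- An inactive node does not transmit, -/
  idle_act : act idle = PMF.pure (idle, none)
  /-- and stays inactive until it hears a transmission. -/
  idle_hear : hear idle none = idle

namespace BlindAlgorithm

open Classical in
/-- The initial configuration, with source `s` and source message `m`. -/
def init {M V : Type} (A : BlindAlgorithm M) (s : V) (m : M) (v : V) : A.State :=
  if v = s then A.start m else A.idle

/-- The law of the next configuration: all nodes act, independently of each other, and then update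
their states according to what they hear. -/
def step {M V : Type} [Fintype V] (A : BlindAlgorithm M) (G : Digraph V) (σ : V → A.State) :
    PMF (V → A.State) :=
  (independent fun v => A.act (σ v)).map fun r v =>
    A.hear (r v).1 (heard G (fun u => (r u).2) v)

/-- The law of the configuration after `τ` time-steps. -/
def run {M V : Type} [Fintype V] (A : BlindAlgorithm M) (G : Digraph V) (s : V) (m : M) :
    ℕ → PMF (V → A.State)
  | 0 => PMF.pure (A.init s m)
  | τ + 1 => (run A G s m τ).bind (A.step G)

/-- The probability that after `τ` time-steps some node does not know the source message `m`. -/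
def failureProb {M V : Type} [Fintype V] (A : BlindAlgorithm M) (G : Digraph V) (s : V) (m : M)
    (τ : ℕ) : ℝ≥0∞ :=
  (A.run G s m τ).toOuterMeasure {σ | ¬ ∀ v, A.learned (σ v) = some m}

end BlindAlgorithm

/-! ### The broadcast framework -/

/-- A protocol for use in the framework. -/
structure Protocol where
  /-- The distribution from which the source draws the global random variable of a time-step,
  depending on the length `T` of the iteration. -/
  guess : ℕ → PMF ℕ
  /-- The transmission probability, depending on `T` and the global random variable. -/
  prob : ℕ → ℕ → ℝ≥0
  prob_le_one : ∀ T x, prob T x ≤ 1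

/-- What an active node knows, and transmits: the source message, the list
`(S_1, x_1), …, (S_T, x_T)` of the current iteration (whose length is `T`), and the number of
time-steps of this iteration that are already over. -/
structure Packet (C : ℕ) (M : Type) where
  payload : M
  schedule : List (Fin C × ℕ)
  pos : ℕ

/-- Move on to the next time-step of the iteration; `none` when the iteration is over. -/
def Packet.next {C : ℕ} {M : Type} (p : Packet C M) : Option (Packet C M) :=
  if p.pos + 1 < p.schedule.length then some { p with pos := p.pos + 1 } else none

/-- The state of a node in the framework. A node is active if `packet` is not `none`. -/
structure NodeState (C : ℕ) (M : Type) where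
  /-- At the source: the source message, and the number of iterations started so far. -/
  source : Option (M × ℕ)
  /-- The source message, if the node has ever been informed of it. -/
  known : Option M
  packet : Option (Packet C M)

namespace Framework

/-- The law of the pair `(S_j, x_j)`: a uniformly chosen protocol, and a sample of its distribution
for iterations of length `T`. -/
def entry {C : ℕ} [NeZero C] (P : Fin C → Protocol) (T : ℕ) : PMF (Fin C × ℕ) :=
  (PMF.uniformOfFintype (Fin C)).bind fun i => ((P i).guess T).map fun x => (i, x)

/-- At the beginning of an iteration (the source holds no packet) the source, which has started
`t` iterations so far, draws the `T = 2 ^ (t + 1)` pairs `(S_j, x_j)` of iteration `t + 1`. In all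
other cases nothing happens. -/
def prepare {C : ℕ} [NeZero C] (P : Fin C → Protocol) {M : Type} (σ : NodeState C M) :
    PMF (NodeState C M) :=
  match σ.source, σ.packet with
  | some (m, t), none =>
      (samples (entry P (2 ^ (t + 1))) (2 ^ (t + 1))).map fun l =>
        { σ with source := some (m, t + 1), packet := some ⟨m, l, 0⟩ }
  | _, _ => PMF.pure σ

/-- The probability with which the holder of a packet transmits in the current time-step. -/
def transmitProb {C : ℕ} (P : Fin C → Protocol) {M : Type} (p : Packet C M) : ℝ≥0 :=
  match p.schedule[p.pos]? with
  | some (i, x) => (P i).prob p.schedule.length x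
  | none => 0

lemma transmitProb_le_one {C : ℕ} (P : Fin C → Protocol) {M : Type} (p : Packet C M) :
    transmitProb P p ≤ 1 := by
  unfold transmitProb
  split
  · exact (P _).prob_le_one _ _
  · exact zero_le_one

/-- Active nodes transmit their packet with the prescribed probability; others listen. -/
def act {C : ℕ} [NeZero C] (P : Fin C → Protocol) {M : Type} (σ : NodeState C M) :
    PMF (NodeState C M × Option (Packet C M)) :=
  (prepare P σ).bind fun σ' =>
    match σ'.packet with
    | none => PMF.pure (σ', none)
    | some p => (coin (transmitProb P p) (transmitProb_le_one P p)).map fun b =>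
        (σ', if b then some p else none)

/-- An inactive node that hears a packet becomes active. Active nodes move on to the next
time-step, and become inactive at the end of the iteration. -/
def hear {C : ℕ} {M : Type} (σ : NodeState C M) (h : Option (Packet C M)) :
     NodeState C M where
  source := σ.source
  known := σ.known.or (h.map Packet.payload)
  packet := (σ.packet.or h).bind Packet.next

end Framework

/-- The broadcast framework: for `t = 1, 2, …`, an iteration of length `T = 2 ^ t`, in which the
source draws independent uniform `S_j ∈ [C]` and independent `x_j` from the distribution of
protocol `S_j` and appends them to the source message, and in time-step `j` of which the active
nodes transmit independently with the probability that protocol `S_j` prescribes for `T` and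
`x_j`. At the end of the iteration all nodes but the source become inactive. -/
def framework {C : ℕ} [NeZero C] (P : Fin C → Protocol) (M : Type) : BlindAlgorithm M where
  State := NodeState C M
  Msg := Packet C M
  start m := ⟨some (m, 0), some m, none⟩
  idle := ⟨none, none, none⟩
  act := Framework.act P
  hear := Framework.hear
  learned := NodeState.known
  idle_act := by simp [Framework.act, Framework.prepare]
  idle_hear := by simp [Framework.hear]

/-! ### The two protocols -/

/-- `log x` means `max (log₂ x) 1`. -/
def log (x : ℝ) : ℝ := max (Real.logb 2 x) 1

/-- The probability of `y` in Shallow-Broadcast: `c / √T` for `1 ≤ y ≤ √T / c`. -/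
def shallowWeight (c : ℝ) (T y : ℕ) : ℝ≥0∞ :=
  if 1 ≤ y ∧ y ≤ ⌊√T / c⌋₊ then ENNReal.ofReal (c / √T) else 0

lemma tsum_shallowWeight_le (c : ℝ) (T : ℕ) : ∑' y, shallowWeight c T (y + 1) ≤ 1 := by
  have h0 : ∀ y ∉ Finset.range ⌊√T / c⌋₊, shallowWeight c T (y + 1) = 0 := by
    intro y hy
    rw [Finset.mem_range] at hy
    exact if_neg (by omega)
  rw [tsum_eq_sum h0]
  calc ∑ y ∈ Finset.range ⌊√T / c⌋₊, shallowWeight c T (y + 1)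
      ≤ ∑ y ∈ Finset.range ⌊√T / c⌋₊, ENNReal.ofReal (c / √T) := by
        refine Finset.sum_le_sum fun y _ => ?_
        unfold shallowWeight
        split <;> simp
    _ = ENNReal.ofReal (⌊√T / c⌋₊ * (c / √T)) := by
        rw [Finset.sum_const, Finset.card_range, nsmul_eq_mul,
          ENNReal.ofReal_mul (Nat.cast_nonneg _), ENNReal.ofReal_natCast]
    _ ≤ 1 := by
        rw [ENNReal.ofReal_le_one]
        rcases le_or_gt (√T / c) 0 with h | h
        · simp [Nat.floor_of_nonpos h]
        · calc (⌊√T / c⌋₊ : ℝ) * (c / √T) ≤ (√T / c) * (c / √T) := by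
                refine mul_le_mul_of_nonneg_right (Nat.floor_le h.le) ?_
                rw [← inv_div]
                exact (inv_pos.2 h).le
            _ ≤ 1 := by
                rw [← inv_div (√T : ℝ) c]
                exact (mul_inv_cancel₀ h.ne').le

/-- Shallow-Broadcast with constant `c`. -/
def shallowBroadcast (c : ℝ) : Protocol where
  guess T := withRemainder (shallowWeight c T) (tsum_shallowWeight_le c T)
  prob _ x := (1 / 2) ^ x
  prob_le_one _ _ := pow_le_one' (by norm_num) _

/-- The probability of `y ≥ 1` in General-Broadcast. -/
def generalWeight (y : ℕ) : ℝ≥0∞ := ENNReal.ofReal (1 / (3 * y * log y ^ 2))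

lemma generalWeight_sum_le (k : ℕ) :
    ∑ y ∈ Finset.Ico (1 : ℕ) (2 ^ (k + 2)), (1 / (3 * (y : ℝ) * log y ^ 2)) ≤
      1 - 1 / (3 * ((k : ℝ) + 1)) := by
  have hlog : ∀ x : ℝ, 1 ≤ log x := fun x => le_max_right _ _
  induction k with
  | zero =>
    have h : Finset.Ico (1 : ℕ) (2 ^ (0 + 2)) = {1, 2, 3} := by decide
    have key : ∀ y : ℝ, 0 < y → 1 / (3 * y * log y ^ 2) ≤ 1 / (3 * y) := by
      intro y hy
      refine one_div_le_one_div_of_le (by positivity) ?_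
      exact le_mul_of_one_le_right (by positivity) (one_le_pow₀ (hlog y))
    rw [h, Finset.sum_insert (by decide), Finset.sum_insert (by decide), Finset.sum_singleton]
    have h1 := (key 1 (by norm_num)).trans_eq (by norm_num : 1 / (3 * (1 : ℝ)) = 1 / 3)
    have h2 := (key 2 (by norm_num)).trans_eq (by norm_num : 1 / (3 * (2 : ℝ)) = 1 / 6)
    have h3 := (key 3 (by norm_num)).trans_eq (by norm_num : 1 / (3 * (3 : ℝ)) = 1 / 9)
    have h4 : (1 : ℝ) - 1 / (3 * (((0 : ℕ) : ℝ) + 1)) = 2 / 3 := by norm_num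
    rw [h4, Nat.cast_one, Nat.cast_ofNat, Nat.cast_ofNat]
    linarith
  | succ k ih =>
    rw [← Finset.sum_Ico_consecutive _ Nat.one_le_two_pow
      (Nat.pow_le_pow_right (by norm_num : 0 < 2) (by omega : k + 2 ≤ k + 1 + 2))]
    have hb : ∑ y ∈ Finset.Ico ((2 : ℕ) ^ (k + 2)) (2 ^ (k + 1 + 2)), (1 / (3 * (y : ℝ) * log y ^ 2)) ≤
        1 / (3 * ((k : ℝ) + 2) ^ 2) := by
      have hterm : ∀ y ∈ Finset.Ico ((2 : ℕ) ^ (k + 2)) (2 ^ (k + 1 + 2)),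
          (1 / (3 * (y : ℝ) * log y ^ 2)) ≤ 1 / (3 * 2 ^ (k + 2) * ((k : ℝ) + 2) ^ 2) := by
        intro y hy
        have hy' : (2 : ℝ) ^ (k + 2) ≤ y := by exact_mod_cast (Finset.mem_Ico.1 hy).1
        have hl : (k : ℝ) + 2 ≤ log y := by
          refine le_trans ?_ (le_max_left _ _)
          rw [Real.le_logb_iff_rpow_le (by norm_num) (lt_of_lt_of_le (by positivity) hy')]
          calc (2 : ℝ) ^ ((k : ℝ) + 2) = 2 ^ (k + 2) := by
                rw [← Real.rpow_natCast]; push_cast; rfl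
            _ ≤ y := hy'
        gcongr
      refine (Finset.sum_le_sum hterm).trans (le_of_eq ?_)
      have hc : 2 ^ (k + 1 + 2) - 2 ^ (k + 2) = 2 ^ (k + 2) := by
        rw [show k + 1 + 2 = (k + 2) + 1 by ring, pow_succ]; omega
      rw [Finset.sum_const, Nat.card_Ico, hc, nsmul_eq_mul]
      push_cast
      field_simp
    have hk : 1 / (3 * ((k : ℝ) + 2) ^ 2) ≤ 1 / (3 * (k + 1)) - 1 / (3 * (k + 2)) := by
      have : 1 / (3 * ((k : ℝ) + 1)) - 1 / (3 * (k + 2)) = 1 / (3 * ((k + 1) * (k + 2))) := by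
        field_simp; ring
      rw [this]
      refine one_div_le_one_div_of_le (by positivity) ?_
      nlinarith [(Nat.cast_nonneg k : (0 : ℝ) ≤ k)]
    have e : ((k + 1 : ℕ) : ℝ) + 1 = k + 2 := by push_cast; ring
    rw [e]
    linarith

lemma tsum_generalWeight_le : ∑' y, generalWeight (y + 1) ≤ 1 := by
  have hpos : ∀ y : ℕ, 0 ≤ 1 / (3 * (y : ℝ) * log y ^ 2) := fun y => by positivity
  refine ENNReal.tsum_le_of_sum_range_le fun n => ?_
  unfold generalWeight
  rw [← ENNReal.ofReal_sum_of_nonneg fun y _ => hpos (y + 1), ENNReal.ofReal_le_one]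
  have h := Finset.sum_Ico_eq_sum_range (fun y : ℕ => 1 / (3 * (y : ℝ) * log y ^ 2)) 1 (n + 1)
  simp only [add_tsub_cancel_right, add_comm 1] at h
  rw [← h]
  refine (Finset.sum_le_sum_of_subset_of_nonneg ?_ fun y _ _ => hpos y).trans
    ((generalWeight_sum_le n).trans (sub_le_self _ (by positivity)))
  refine Finset.Ico_subset_Ico_right ?_
  have := (Nat.lt_two_pow_self (n := n + 2))
  omega

/-- General-Broadcast. -/
def generalBroadcast : Protocol where
  guess _ := withRemainder generalWeight tsum_generalWeight_le
  prob _ x := (1 / 2) ^ x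
  prob_le_one _ _ := pow_le_one' (by norm_num) _

/-- The framework with Shallow-Broadcast (with constant `c`) and General-Broadcast. -/
def broadcast (c : ℝ) (M : Type) : BlindAlgorithm M :=
  framework ![shallowBroadcast c, generalBroadcast] M

/-- `D log (n / D) log² log (n / D) + log² n`. -/
def timeBound (n D : ℕ) : ℝ :=
  D * log (n / D) * log (log (n / D)) ^ 2 + log n ^ 2

end RadioNetwork

end

noncomputable section

namespace RadioNetwork

/-! Time up to `τ` contains a last complete iteration, of length `T ≥ τ / 4`. Since knowledge is
never lost, it suffices that each node becomes active during that iteration except with probability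
`n⁻²`; a union bound over the nodes finishes. Within an iteration all active nodes hold the same
packet, so the active set is a growing random set driven by independent coins of a common bias, and
the bias is in effect drawn afresh in every step (`failureProb_le_sum`).

Fix a node and a shortest walk `w` to it, of length `d ≤ D`. The front is the last position on `w`
that some active node can transmit to. Active in-neighbours of the front node have no out-neighbour
further along `w`, so they are counted by `width` at the front, and the widths sum to at most `n`.
If exactly one of them transmits, the front moves on or the end of `w` is active. If this has
probability at least `q i` at position `i`, the product of `(1 - r / q j)⁻¹` over the positions from
the front on shrinks in expectation by the factor `1 - r` per step, wherever the front is. Hence the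
node is missed with probability at most `exp (2 r ∑ 1 / q i - r T)` (`expect_missProb_le_exp`).

Two regimes supply the `q i`. If `D ≤ √T / 64`, Shallow-Broadcast gives `q i` of order `1 / √T`, and
the exponent is at most `-√T / 64`. Otherwise General-Broadcast gives `q i = 1 / cost (width i)`.
The costs sum to `O(D log (n/D) log² log (n/D))` by a linear majorant of `cost` (`sum_cost_le`), and
`T` exceeds `cost n * log n` by a large constant factor because `D` is large
(`log_sq_mul_le_of_timeBound_le`). -/

/-! ### Expectations -/

/-- The expectation of a nonnegative function. -/
def expect {α : Type*} (p : PMF α) (F : α → ℝ≥0∞) : ℝ≥0∞ := ∑' a, p a * F a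

section expect

variable {α β ι : Type*}

lemma expect_pure (a : α) (F : α → ℝ≥0∞) : expect (PMF.pure a) F = F a := by
  unfold expect
  rw [tsum_eq_single a fun b hb => by simp [PMF.pure_apply, hb]]
  simp

lemma expect_bind (p : PMF α) (f : α → PMF β) (F : β → ℝ≥0∞) :
    expect (p.bind f) F = expect p fun a => expect (f a) F := by
  simp only [expect, PMF.bind_apply, ← ENNReal.tsum_mul_right, ← ENNReal.tsum_mul_left]
  rw [ENNReal.tsum_comm]
  simp only [mul_assoc]

lemma expect_map (p : PMF α) (f : α → β) (F : β → ℝ≥0∞) :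
    expect (p.map f) F = expect p fun a => F (f a) := by
  rw [PMF.map, expect_bind]
  simp [expect_pure]

lemma expect_mono_of_mem_support {p : PMF α} {F F' : α → ℝ≥0∞}
    (h : ∀ a ∈ p.support, F a ≤ F' a) : expect p F ≤ expect p F' := by
  refine ENNReal.tsum_le_tsum fun a => ?_
  by_cases ha : p a = 0
  · simp [ha]
  · exact mul_le_mul_right (h a ((PMF.mem_support_iff _ _).2 ha)) _

lemma expect_mono {p : PMF α} {F F' : α → ℝ≥0∞} (h : ∀ a, F a ≤ F' a) :
    expect p F ≤ expect p F' :=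
  expect_mono_of_mem_support fun a _ => h a

lemma expect_const (p : PMF α) (c : ℝ≥0∞) : expect p (fun _ => c) = c := by
  simp [expect, ENNReal.tsum_mul_right]

lemma expect_le_of_forall_mem_support {p : PMF α} {F : α → ℝ≥0∞} {c : ℝ≥0∞}
    (h : ∀ a ∈ p.support, F a ≤ c) : expect p F ≤ c :=
  (expect_mono_of_mem_support h).trans_eq (expect_const p c)

lemma expect_add (p : PMF α) (F F' : α → ℝ≥0∞) :
    expect p (fun a => F a + F' a) = expect p F + expect p F' := by
  simp only [expect, mul_add, ENNReal.tsum_add]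

lemma expect_const_mul (p : PMF α) (c : ℝ≥0∞) (F : α → ℝ≥0∞) :
    expect p (fun a => c * F a) = c * expect p F := by
  simp only [expect, ← ENNReal.tsum_mul_left, mul_left_comm]

lemma expect_finset_sum (p : PMF α) (s : Finset ι) (F : ι → α → ℝ≥0∞) :
    expect p (fun a => ∑ i ∈ s, F i a) = ∑ i ∈ s, expect p (F i) := by
  simp only [expect, Finset.mul_sum]
  exact Summable.tsum_finsetSum fun _ _ => ENNReal.summable

lemma mul_le_expect (p : PMF α) (F : α → ℝ≥0∞) (a : α) : p a * F a ≤ expect p F :=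
  ENNReal.le_tsum a

lemma toOuterMeasure_eq_expect (p : PMF α) (s : Set α) :
    p.toOuterMeasure s = expect p (s.indicator 1) := by
  rw [PMF.toOuterMeasure_apply]
  refine tsum_congr fun a => ?_
  by_cases h : a ∈ s <;> simp [h]

lemma expect_independent_prod [Fintype ι] (p : ι → PMF α) (F : ι → α → ℝ≥0∞) :
    expect (independent p) (fun f => ∏ i, F i (f i)) = ∏ i, expect (p i) (F i) := by
  simp only [expect]
  rw [← tsum_prod_pi]
  refine tsum_congr fun f => ?_
  rw [Finset.prod_mul_distrib]
  rfl

lemma independent_map [Fintype ι] (p : ι → PMF α) (f : ι → α → β) :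
    independent (fun i => (p i).map (f i)) = (independent p).map fun g i => f i (g i) := by
  classical
  ext g
  change ∏ i, (p i).map (f i) (g i) = _
  simp only [PMF.map_apply]
  rw [← tsum_prod_pi]
  refine tsum_congr fun h => ?_
  rw [Finset.prod_ite_zero]
  simp only [Finset.mem_univ, forall_const, funext_iff]
  rfl

/-- A product law is linear in each factor. This lets the source's random schedule be drawn before
all other random choices of a time-step. -/
lemma independent_update_bind [Fintype ι] [DecidableEq ι] (p : ι → PMF α) (i : ι) (q : PMF β)
    (f : β → PMF α) :
    independent (Function.update p i (q.bind f)) =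
      q.bind fun b => independent (Function.update p i (f b)) := by
  ext g
  have key : ∀ r : PMF α, independent (Function.update p i r) g =
      r (g i) * ∏ j ∈ Finset.univ.erase i, p j (g j) := by
    intro r
    change ∏ j, Function.update p i r j (g j) = _
    rw [← Finset.mul_prod_erase _ _ (Finset.mem_univ i), Function.update_self]
    congr 1
    refine Finset.prod_congr rfl fun j hj => ?_
    rw [Function.update_of_ne (Finset.ne_of_mem_erase hj)]
  rw [key, PMF.bind_apply, PMF.bind_apply, ← ENNReal.tsum_mul_right]
  simp only [key, mul_assoc]

lemma length_of_mem_support_samples (p : PMF α) :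
    ∀ {k : ℕ} {l : List α}, l ∈ (samples p k).support → l.length = k
  | 0, l, h => by simpa [samples] using h
  | k + 1, l, h => by
    simp only [samples, PMF.mem_support_bind_iff, PMF.mem_support_map_iff] at h
    obtain ⟨a, -, l', hl', rfl⟩ := h
    simp [length_of_mem_support_samples p hl']

end expect

/-! ### Independent coins -/

/-- Independent coins at all nodes. -/
def coins (V : Type) [Fintype V] (p : ℝ≥0) (hp : p ≤ 1) : PMF (V → Bool) :=
  independent fun _ => coin p hp

lemma coin_true (p : ℝ≥0) (hp : p ≤ 1) : coin p hp true = p := by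
  simp [coin]

lemma coin_false (p : ℝ≥0) (hp : p ≤ 1) : coin p hp false = ((1 - p : ℝ≥0) : ℝ≥0∞) := by
  simp [coin]

lemma expect_coin (p : ℝ≥0) (hp : p ≤ 1) (F : Bool → ℝ≥0∞) :
    expect (coin p hp) F = p * F true + ((1 - p : ℝ≥0) : ℝ≥0∞) * F false := by
  rw [expect, tsum_fintype, Fintype.sum_bool, coin_true, coin_false]

open Classical in
/-- The probability that exactly one of the coins in a nonempty set shows `true`. -/
lemma expect_coins_existsUnique {V : Type} [Fintype V] (p : ℝ≥0) (hp : p ≤ 1) (N : Finset V) :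
    (N.card * (p * (1 - p) ^ (N.card - 1)) : ℝ≥0) ≤
      expect (coins V p hp) fun b => if ∃! u, u ∈ N ∧ b u = true then 1 else 0 := by
  -- The event that `u` alone in `N` shows `true`, as a product of one-coordinate factors, so that
  -- independence applies.
  let single : V → V → Bool → ℝ≥0∞ := fun u w c =>
    if w = u then (if c = true then 1 else 0) else if w ∈ N then (if c = true then 0 else 1) else 1
  have h1 : ∀ u ∈ N, expect (coins V p hp) (fun b => ∏ w, single u w (b w)) =
      (p * (1 - p) ^ (N.card - 1) : ℝ≥0) := by
    intro u hu
    rw [coins, expect_independent_prod]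
    have : ∀ w, expect (coin p hp) (single u w) =
        if w ∈ N then (if w = u then (p : ℝ≥0∞) else ((1 - p : ℝ≥0) : ℝ≥0∞)) else 1 := by
      intro w
      by_cases hw : w = u
      · subst hw
        simp [single, expect_coin, hu]
      · by_cases hN : w ∈ N
        · simp [single, expect_coin, hw, hN]
        · simp only [single, hw, hN, if_false, expect_const]
    simp only [this]
    rw [Finset.prod_ite_mem, Finset.univ_inter, ← Finset.mul_prod_erase _ _ hu, if_pos rfl,
      Finset.prod_congr rfl fun w hw => if_neg (Finset.ne_of_mem_erase hw), Finset.prod_const,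
      Finset.card_erase_of_mem hu]
    push_cast
    rfl
  calc ((N.card * (p * (1 - p) ^ (N.card - 1)) : ℝ≥0) : ℝ≥0∞)
      = ∑ u ∈ N, expect (coins V p hp) (fun b => ∏ w, single u w (b w)) := by
        rw [Finset.sum_congr rfl h1, Finset.sum_const, nsmul_eq_mul]
        push_cast
        rfl
    _ = expect (coins V p hp) fun b => ∑ u ∈ N, ∏ w, single u w (b w) :=
        (expect_finset_sum _ _ _).symm
    _ ≤ _ := by
        refine expect_mono fun b => ?_
        -- These events are disjoint for different `u`, so at most one summand is nonzero.
        have h0 : ∀ u, (∏ w, single u w (b w) ≠ 0) → b u = true ∧ ∀ w ∈ N, b w = true → w = u := by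
          intro u hne
          rw [Finset.prod_ne_zero_iff] at hne
          refine ⟨?_, fun w hw hb => ?_⟩
          · by_contra hb
            exact hne u (Finset.mem_univ _) (by simp [single, hb])
          · by_contra hwu
            exact hne w (Finset.mem_univ _) (by simp [single, hwu, hw, hb])
        by_cases hex : ∃ u ∈ N, ∏ w, single u w (b w) ≠ 0
        · obtain ⟨u, hu, hne⟩ := hex
          obtain ⟨hb, huniq⟩ := h0 u hne
          rw [if_pos ⟨u, ⟨hu, hb⟩, fun w hw => huniq w hw.1 hw.2⟩,
            Finset.sum_eq_single u (fun w hw hwu => ?_) (fun h => absurd hu h)]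
          · refine Finset.prod_le_one' fun w _ => ?_
            simp only [single]
            split_ifs <;> simp
          · by_contra hne'
            exact hwu (huniq w hw (h0 w hne').1)
        · push Not at hex
          rw [Finset.sum_eq_zero hex]
          exact zero_le

/-! ### The spread of the active set for a given schedule -/

/-- The active nodes after a time-step in which the nodes in `A` are active, and those of them
whose coins show `true` transmit. -/
def spread {V : Type} (G : Digraph V) (A : Set V) (b : V → Bool) : Set V :=
  A ∪ {v | ∃! u, G.Adj u v ∧ u ∈ A ∧ b u = true}

/-- The coins of the nodes in a time-step with schedule entry `e`. -/
def entryCoins {C : ℕ} (P : Fin C → Protocol) (T : ℕ) (V : Type) [Fintype V] (e : Fin C × ℕ) :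
    PMF (V → Bool) :=
  coins V ((P e.1).prob T e.2) ((P e.1).prob_le_one T e.2)

open Classical in
/-- The probability that `v` does not become active in the course of a given schedule. -/
def missProb {C : ℕ} (P : Fin C → Protocol) (T : ℕ) {V : Type} [Fintype V] (G : Digraph V) (v : V) :
    List (Fin C × ℕ) → Set V → ℝ≥0∞
  | [], A => if v ∈ A then 0 else 1
  | e :: l, A => expect (entryCoins P T V e) fun b => missProb P T G v l (spread G A b)

open Classical in
/-- If a potential dominates the indicator of the event that `v` is inactive, and contracts in
expectation in every time-step, then the probability that `v` stays inactive decays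
geometrically. -/
lemma expect_missProb_le {C : ℕ} (P : Fin C → Protocol) (T : ℕ) {V : Type} [Fintype V]
    (G : Digraph V) (s v : V) (p : PMF (Fin C × ℕ)) (F : Set V → ℝ≥0∞) (c : ℝ≥0∞)
    (hF : ∀ A, s ∈ A → v ∉ A → 1 ≤ F A)
    (hdrift : ∀ A, s ∈ A →
      (expect p fun e => expect (entryCoins P T V e) fun b => F (spread G A b)) ≤ c * F A) :
    ∀ (k : ℕ) (A : Set V), s ∈ A →
      (expect (samples p k) fun l => missProb P T G v l A) ≤ c ^ k * F A
  | 0, A, hA => by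
    simp only [samples, expect_pure, missProb, pow_zero, one_mul]
    split_ifs with h
    · exact zero_le
    · exact hF A hA h
  | k + 1, A, hA => by
    -- The later schedule entries are independent of the present coins, so they may be drawn after
    -- them.
    have hswap : ∀ e, (expect (samples p k) fun l => expect (entryCoins P T V e) fun b =>
          missProb P T G v l (spread G A b)) =
        expect (entryCoins P T V e) fun b => expect (samples p k) fun l =>
          missProb P T G v l (spread G A b) := by
      intro e
      simp only [expect, ← ENNReal.tsum_mul_left]
      rw [ENNReal.tsum_comm]
      simp only [mul_left_comm]
    simp only [samples, expect_bind, expect_map, missProb, hswap]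
    calc _ ≤ expect p fun e => expect (entryCoins P T V e) fun b => c ^ k * F (spread G A b) :=
          expect_mono fun e => expect_mono fun b =>
            expect_missProb_le P T G s v p F c hF hdrift k _ (Or.inl hA)
      _ = c ^ k * expect p fun e => expect (entryCoins P T V e) fun b => F (spread G A b) := by
          simp only [expect_const_mul]
      _ ≤ c ^ k * (c * F A) := by gcongr; exact hdrift A hA
      _ = c ^ (k + 1) * F A := by ring

/-! ### Configurations of the framework -/

namespace Framework

variable {C : ℕ} {M V : Type}

open Classical in
/-- The configurations at the beginning of iteration `t + 1`. -/
structure AtStart (s : V) (m : M) (t : ℕ) (σ : V → NodeState C M) : Prop where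
  source : ∀ v, (σ v).source = if v = s then some (m, t) else none
  known : ∀ v, (σ v).known = none ∨ (σ v).known = some m
  known_source : (σ s).known = some m
  packet : ∀ v, (σ v).packet = none

open Classical in
/-- The configurations `j` time-steps after the beginning of iteration `t`, where `l` is the
schedule of the iteration and `A` is the set of active nodes (before they become inactive at the
end of the iteration). -/
structure During (s : V) (m : M) (t : ℕ) (l : List (Fin C × ℕ)) (j : ℕ) (A : Set V)
    (σ : V → NodeState C M) : Prop where
  source : ∀ v, (σ v).source = if v = s then some (m, t) else none
  known : ∀ v, (σ v).known = none ∨ (σ v).known = some m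
  mem_source : s ∈ A
  known_of_mem : ∀ v ∈ A, (σ v).known = some m
  packet : ∀ v, (σ v).packet = if v ∈ A ∧ j < l.length then some ⟨m, l, j⟩ else none

lemma During.atStart {s : V} {m : M} {t : ℕ} {l : List (Fin C × ℕ)} {A : Set V}
    {σ : V → NodeState C M} (h : During s m t l l.length A σ) : AtStart s m t σ where
  source := h.source
  known := h.known
  known_source := h.known_of_mem s h.mem_source
  packet v := by simp [h.packet]

/-- The new configuration, if exactly those active nodes transmit whose coins show `true`. -/
def advance (G : Digraph V) (σ : V → NodeState C M) (b : V → Bool) (v : V) : NodeState C M :=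
  hear (σ v) (heard G (fun u => if b u then (σ u).packet else none) v)

/-- All active nodes hold the same packet, so it does not matter which of them is heard. -/
lemma During.heard_eq (G : Digraph V) {s : V} {m : M} {t : ℕ}
    {l : List (Fin C × ℕ)} {j : ℕ} {A : Set V} {σ : V → NodeState C M}
    (h : During s m t l j A σ) (b : V → Bool) (v : V) :
    heard G (fun u => if b u then (σ u).packet else none) v = none ∨
      heard G (fun u => if b u then (σ u).packet else none) v = some ⟨m, l, j⟩ := by
  unfold heard
  split_ifs with hh
  · right
    have := hh.2.choose_spec.1.2
    simp only [h.packet] at this ⊢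
    split_ifs at this ⊢ <;> simp_all
  · exact Or.inl rfl

-- An inactive node holds no packet and therefore listens; while `j < l.length`, the transmitters
-- are exactly the active nodes whose coins show `true`.
open Classical in
lemma During.heard_iff (G : Digraph V) {s : V} {m : M} {t : ℕ}
    {l : List (Fin C × ℕ)} {j : ℕ} {A : Set V} {σ : V → NodeState C M}
    (h : During s m t l j A σ) (hj : j < l.length) (b : V → Bool) {v : V} (hv : v ∉ A) :
    heard G (fun u => if b u then (σ u).packet else none) v =
      if v ∈ spread G A b then some ⟨m, l, j⟩ else none := by
  have hsome : ∀ u, ((if b u then (σ u).packet else none).isSome ↔ u ∈ A ∧ b u = true) := by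
    intro u
    rw [h.packet]
    by_cases hb : b u = true <;> by_cases hu : u ∈ A <;> simp [hb, hu, hj]
  have hnone : (if b v then (σ v).packet else none) = none := by
    rw [h.packet]; simp [hv]
  split_ifs with hs
  · refine (h.heard_eq G b v).resolve_left fun hn => ?_
    have hc : ∃! u, G.Adj u v ∧ (if b u then (σ u).packet else none).isSome := by
      simp only [hsome]
      exact hs.resolve_left hv
    unfold heard at hn
    rw [dif_pos ⟨hnone, hc⟩] at hn
    have := hc.choose_spec.1.2
    simp only [hn] at this
    exact Bool.false_ne_true this
  · unfold heard
    rw [dif_neg]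
    rintro ⟨-, hc⟩
    simp only [hsome] at hc
    exact hs (Or.inr hc)

lemma During.during_advance {G : Digraph V} {s : V} {m : M} {t : ℕ}
    {l : List (Fin C × ℕ)} {j : ℕ} {A : Set V} {σ : V → NodeState C M}
    (h : During s m t l j A σ) (hj : j < l.length) (b : V → Bool) :
    During s m t l (j + 1) (spread G A b) (advance G σ b) where
  source v := h.source v
  known v := by
    change ((σ v).known.or _) = none ∨ ((σ v).known.or _) = some m
    rcases h.known v with hk | hk <;> rcases h.heard_eq G b v with hh | hh <;> simp [hk, hh]
  mem_source := Or.inl h.mem_source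
  known_of_mem v hv := by
    change (σ v).known.or _ = some m
    by_cases hA : v ∈ A
    · simp [h.known_of_mem v hA]
    · rw [h.heard_iff G hj b hA, if_pos hv]
      rcases h.known v with hk | hk <;> simp [hk]
  -- A newly informed node applies `Packet.next` to what it hears in the same time-step, so old and
  -- new active nodes agree on the position, and on the end of the iteration.
  packet v := by
    change ((σ v).packet.or _).bind Packet.next = _
    by_cases hA : v ∈ A
    · have : v ∈ spread G A b := Or.inl hA
      simp [h.packet, hA, this, hj, Packet.next]
    · rw [h.heard_iff G hj b hA, h.packet]
      by_cases hs : v ∈ spread G A b <;> simp [hA, hs, Packet.next]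

open Classical in
/-- The configuration after the source has drawn the schedule `l`. -/
def load (s : V) (m : M) (t : ℕ) (σ : V → NodeState C M) (l : List (Fin C × ℕ)) :
    V → NodeState C M :=
  Function.update σ s
    { σ s with source := some (m, t + 1), packet := some ⟨m, l, 0⟩ }

lemma AtStart.during_load {s : V} {m : M} {t : ℕ} {σ : V → NodeState C M} (h : AtStart s m t σ)
    {l : List (Fin C × ℕ)} (hl : 0 < l.length) :
    During s m (t + 1) l 0 {s} (load s m t σ l) where
  source v := by
    by_cases hv : v = s
    · subst hv; simp [load]
    · simp [load, hv, h.source]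
  known v := by
    by_cases hv : v = s
    · subst hv; simpa [load] using h.known v
    · simpa [load, hv] using h.known v
  mem_source := rfl
  known_of_mem v hv := by
    obtain rfl : v = s := hv
    simpa [load] using h.known_source
  packet v := by
    by_cases hv : v = s
    · subst hv; simp [load, hl]
    · simp [load, hv, h.packet]

/-! ### The law of the configuration in the course of an iteration. -/

variable [NeZero C] [Fintype V]

/-- The law of the next configuration. -/
def step (P : Fin C → Protocol) (G : Digraph V) (σ : V → NodeState C M) :
    PMF (V → NodeState C M) :=
  (independent fun v => act P (σ v)).map fun r v => hear (r v).1 (heard G (fun u => (r u).2) v)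

/-- The law of the configuration `k` time-steps after the configuration `σ`. -/
def evolve (P : Fin C → Protocol) (G : Digraph V) : ℕ → (V → NodeState C M) →
    PMF (V → NodeState C M)
  | 0, σ => PMF.pure σ
  | k + 1, σ => (step P G σ).bind (evolve P G k)

lemma evolve_add (P : Fin C → Protocol) (G : Digraph V) (k : ℕ) :
    ∀ (j : ℕ) (σ : V → NodeState C M),
      evolve P G (j + k) σ = (evolve P G j σ).bind (evolve P G k)
  | 0, σ => by rw [zero_add, evolve, PMF.pure_bind]
  | j + 1, σ => by
    rw [Nat.succ_add, evolve, evolve, PMF.bind_bind]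
    congr 1
    exact funext fun σ' => evolve_add P G k j σ'

lemma evolve_one (P : Fin C → Protocol) (G : Digraph V) :
    evolve (M := M) P G 1 = step P G :=
  funext fun _ => PMF.bind_pure _

open Classical in
/-- The initial configuration. -/
def initial (s : V) (m : M) (v : V) : NodeState C M :=
  if v = s then ⟨some (m, 0), some m, none⟩ else ⟨none, none, none⟩

/-- `run` adds time-steps at the end, `evolve` at the beginning; the latter suits inductions that
start from the current configuration. -/
lemma run_eq_evolve (P : Fin C → Protocol) (G : Digraph V) (s : V) (m : M) :
    ∀ τ, (framework P M).run G s m τ = evolve P G τ (initial s m)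
  | 0 => rfl
  | τ + 1 => by
    rw [evolve_add, evolve_one, ← run_eq_evolve P G s m τ]
    rfl

lemma failureProb_eq (P : Fin C → Protocol) (G : Digraph V) (s : V) (m : M) (τ : ℕ) :
    (framework P M).failureProb G s m τ =
      expect (evolve P G τ (initial s m)) ({σ | ¬ ∀ v, (σ v).known = some m}.indicator 1) := by
  rw [← toOuterMeasure_eq_expect, ← run_eq_evolve]
  rfl

lemma act_eq {P : Fin C → Protocol} {σ : NodeState C M} (h : prepare P σ = PMF.pure σ)
    {p : ℝ≥0} (hp : p ≤ 1) (hpacket : ∀ q, σ.packet = some q → transmitProb P q = p) :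
    act P σ = (coin p hp).map fun b => (σ, if b then σ.packet else none) := by
  rw [act, h, PMF.pure_bind]
  cases hσ : σ.packet with
  | none =>
    -- An inactive node gets a coin without effect, so that all nodes have coins of the same law.
    simp only [ite_self]
    exact (PMF.map_const _ _).symm
  | some q =>
    obtain rfl := hpacket q hσ
    rfl

lemma step_eq (P : Fin C → Protocol) (G : Digraph V) {σ : V → NodeState C M}
    (h : ∀ v, prepare P (σ v) = PMF.pure (σ v)) {p : ℝ≥0} (hp : p ≤ 1)
    (hpacket : ∀ v q, (σ v).packet = some q → transmitProb P q = p) :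
    step P G σ = (coins V p hp).map (advance G σ) := by
  have : (fun v => act P (σ v)) = fun v =>
      (coin p hp).map fun b => (σ v, if b then (σ v).packet else none) :=
    funext fun v => act_eq (h v) hp (hpacket v)
  rw [Framework.step, this, independent_map, PMF.map_comp]
  rfl

lemma During.step_eq {P : Fin C → Protocol} (G : Digraph V) {s : V} {m : M} {t : ℕ}
    {l : List (Fin C × ℕ)} {j : ℕ} {A : Set V} {σ : V → NodeState C M}
    (h : During s m t l j A σ) (hj : j < l.length) :
    step P G σ = (entryCoins P l.length V l[j]).map (advance G σ) := by
  refine Framework.step_eq P G (fun v => ?_) _ fun v q hq => ?_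
  · by_cases hv : v = s
    · have : (σ v).packet = some ⟨m, l, j⟩ := by
        rw [h.packet, if_pos ⟨hv ▸ h.mem_source, hj⟩]
      unfold prepare
      simp [this]
    · unfold prepare
      simp [h.source, hv]
  · rw [h.packet] at hq
    split_ifs at hq
    cases hq
    simp [transmitProb, hj]

/-- The schedule is drawn inside the first time-step. As `prepare` does nothing once a packet is
loaded, drawing can be separated from acting. -/
lemma AtStart.step_eq {P : Fin C → Protocol} (G : Digraph V) {s : V} {m : M} {t : ℕ}
    {σ : V → NodeState C M} (h : AtStart s m t σ) :
    step P G σ = (samples (entry P (2 ^ (t + 1))) (2 ^ (t + 1))).bind fun l =>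
      step P G (load s m t σ l) := by
  classical
  have h1 : ∀ l, (fun v => act P (load s m t σ l v)) =
      Function.update (fun v => act P (σ v)) s (act P (load s m t σ l s)) := by
    intro l
    funext v
    by_cases hv : v = s
    · subst hv; simp
    · simp [load, hv]
  have h2 : act P (σ s) = (samples (entry P (2 ^ (t + 1))) (2 ^ (t + 1))).bind fun l =>
      act P (load s m t σ l s) := by
    have hprep : ∀ l, prepare P (load s m t σ l s) = PMF.pure (load s m t σ l s) := by
      intro l
      unfold prepare
      simp [load]
    have hprep' : prepare P (σ s) =
        (samples (entry P (2 ^ (t + 1))) (2 ^ (t + 1))).map fun l => load s m t σ l s := by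
      have hs := h.source s
      rw [if_pos rfl] at hs
      unfold prepare
      rw [hs, h.packet]
      simp [load]
    rw [act, hprep', PMF.bind_map]
    congr 1
    funext l
    rw [act, hprep, PMF.pure_bind]
    rfl
  have h3 : (fun v => act P (σ v)) =
      Function.update (fun v => act P (σ v)) s (act P (σ s)) := by
    rw [Function.update_eq_self]
  simp only [Framework.step]
  rw [h3, h2, independent_update_bind, PMF.map_bind]
  simp only [h1]

lemma AtStart.evolve_eq {P : Fin C → Protocol} (G : Digraph V) {s : V} {m : M} {t : ℕ}
    {σ : V → NodeState C M} (h : AtStart s m t σ) {k : ℕ} (hk : 0 < k) :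
    evolve P G k σ = (samples (entry P (2 ^ (t + 1))) (2 ^ (t + 1))).bind fun l =>
      evolve P G k (load s m t σ l) := by
  obtain ⟨k, rfl⟩ := Nat.exists_eq_succ_of_ne_zero hk.ne'
  simp only [evolve]
  rw [h.step_eq, PMF.bind_bind]

lemma During.evolve_atStart {P : Fin C → Protocol} {G : Digraph V} {s : V} {m : M} {t : ℕ}
    {l : List (Fin C × ℕ)} :
    ∀ {k j : ℕ} {A : Set V} {σ : V → NodeState C M}, During s m t l j A σ → j + k = l.length →
      ∀ σ' ∈ (evolve P G k σ).support, AtStart s m t σ'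
  | 0, j, A, σ, h, hk, σ', hσ' => by
    obtain rfl : σ' = σ := (PMF.mem_support_pure_iff _ _).1 hσ'
    obtain rfl : j = l.length := hk
    exact h.atStart
  | k + 1, j, A, σ, h, hk, σ', hσ' => by
    have hj : j < l.length := by omega
    rw [evolve, h.step_eq G hj, PMF.mem_support_bind_iff] at hσ'
    obtain ⟨σ₁, hσ₁, hσ'⟩ := hσ'
    rw [PMF.mem_support_map_iff] at hσ₁
    obtain ⟨b, -, rfl⟩ := hσ₁
    exact (h.during_advance hj b).evolve_atStart (by omega) σ' hσ'

open Classical in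
lemma During.expect_evolve_le {P : Fin C → Protocol} {G : Digraph V} {s : V} {m : M} {t : ℕ}
    {l : List (Fin C × ℕ)} (v : V) :
    ∀ {k j : ℕ} {A : Set V} {σ : V → NodeState C M}, During s m t l j A σ → j + k = l.length →
      expect (evolve P G k σ) (fun σ' => if (σ' v).known = some m then 0 else 1) ≤
        missProb P l.length G v (l.drop j) A
  | 0, j, A, σ, h, hk => by
    obtain rfl : j = l.length := hk
    rw [evolve, expect_pure, List.drop_length, missProb]
    by_cases hv : v ∈ A
    · simp [h.known_of_mem v hv]
    -- Only an inequality: an inactive node may know the message from an earlier iteration.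
    · rw [if_neg hv]
      split_ifs <;> simp
  | k + 1, j, A, σ, h, hk => by
    have hj : j < l.length := by omega
    rw [evolve, h.step_eq G hj, expect_bind, expect_map,
      List.drop_eq_getElem_cons hj, missProb]
    exact expect_mono fun b => (h.during_advance hj b).expect_evolve_le v (by omega)

lemma AtStart.evolve_atStart {P : Fin C → Protocol} {G : Digraph V} {s : V} {m : M} {t : ℕ}
    {σ : V → NodeState C M} (h : AtStart s m t σ) :
    ∀ σ' ∈ (evolve P G (2 ^ (t + 1)) σ).support, AtStart s m (t + 1) σ' := by
  intro σ' hσ'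
  rw [h.evolve_eq G (by positivity), PMF.mem_support_bind_iff] at hσ'
  obtain ⟨l, hl, hσ'⟩ := hσ'
  have hlen := length_of_mem_support_samples _ hl
  exact (h.during_load (hlen ▸ by positivity)).evolve_atStart (by omega) σ' hσ'

open Classical in
lemma AtStart.expect_evolve_le {P : Fin C → Protocol} {G : Digraph V} {s : V} {m : M} {t : ℕ}
    {σ : V → NodeState C M} (h : AtStart s m t σ) (v : V) :
    expect (evolve P G (2 ^ (t + 1)) σ)
        (fun σ' => if (σ' v).known = some m then 0 else 1) ≤
      expect (samples (entry P (2 ^ (t + 1))) (2 ^ (t + 1))) fun l =>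
        missProb P (2 ^ (t + 1)) G v l {s} := by
  rw [h.evolve_eq G (by positivity), expect_bind]
  refine expect_mono_of_mem_support fun l hl => ?_
  have hlen := length_of_mem_support_samples _ hl
  have := (h.during_load (l := l) (hlen ▸ by positivity)).expect_evolve_le (P := P) (G := G) v
    (k := 2 ^ (t + 1)) (by omega)
  simpa [hlen] using this

/-! ### Reduction of the failure probability to a single iteration. -/

/-- The first `t` iterations take `2 + 4 + ⋯ + 2 ^ t = 2 ^ (t + 1) - 2` time-steps. -/
lemma atStart_of_mem_support_run {P : Fin C → Protocol} {G : Digraph V} {s : V} {m : M} :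
    ∀ (t : ℕ), ∀ σ ∈ (evolve P G (2 ^ (t + 1) - 2) (initial s m)).support, AtStart s m t σ
  | 0, σ, hσ => by
    obtain rfl : σ = initial s m := (PMF.mem_support_pure_iff _ _).1 hσ
    constructor
    all_goals first | intro v | skip
    · by_cases hv : v = s <;> simp [initial, hv]
    · by_cases hv : v = s <;> simp [initial, hv]
    · simp [initial]
    · by_cases hv : v = s <;> simp [initial, hv]
  | t + 1, σ, hσ => by
    have : 2 ^ (t + 1 + 1) - 2 = (2 ^ (t + 1) - 2) + 2 ^ (t + 1) := by
      have := Nat.one_le_two_pow (n := t)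
      rw [pow_succ, pow_succ]
      omega
    rw [this, evolve_add, PMF.mem_support_bind_iff] at hσ
    obtain ⟨σ₀, hσ₀, hσ⟩ := hσ
    exact (atStart_of_mem_support_run t σ₀ hσ₀).evolve_atStart σ hσ

/-- A node that knows the source message does not forget it. -/
lemma known_of_mem_support_step {P : Fin C → Protocol} {G : Digraph V} {m : M}
    {σ σ' : V → NodeState C M} (h : σ' ∈ (step P G σ).support) {v : V}
    (hv : (σ v).known = some m) : (σ' v).known = some m := by
  rw [Framework.step, PMF.mem_support_map_iff] at h
  obtain ⟨r, hr, rfl⟩ := h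
  have hrv : r v ∈ (act P (σ v)).support := by
    rw [PMF.mem_support_iff] at hr ⊢
    exact (Finset.prod_ne_zero_iff.1 hr) v (Finset.mem_univ v)
  have hprep : ∀ ρ ∈ (prepare P (σ v)).support, ρ.known = (σ v).known := by
    intro ρ hρ
    unfold prepare at hρ
    split at hρ
    · rw [PMF.mem_support_map_iff] at hρ
      obtain ⟨l, -, rfl⟩ := hρ
      rfl
    · rw [(PMF.mem_support_pure_iff _ _).1 hρ]
  rw [act, PMF.mem_support_bind_iff] at hrv
  obtain ⟨ρ, hρ, hrv⟩ := hrv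
  have hr1 : (r v).1 = ρ := by
    split at hrv
    · rw [(PMF.mem_support_pure_iff _ _).1 hrv]
    · rw [PMF.mem_support_map_iff] at hrv
      obtain ⟨b, -, hb⟩ := hrv
      rw [← hb]
  change ((r v).1.known.or _) = some m
  rw [hr1, hprep ρ hρ, hv]
  rfl

lemma failureProb_antitone (P : Fin C → Protocol) (G : Digraph V) (s : V) (m : M) :
    Antitone ((framework P M).failureProb G s m) := by
  refine antitone_nat_of_succ_le fun τ => ?_
  rw [failureProb_eq, failureProb_eq, evolve_add, evolve_one, expect_bind]
  refine expect_mono fun σ => ?_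
  by_cases h : ∀ v, (σ v).known = some m
  · refine expect_le_of_forall_mem_support fun σ' hσ' => ?_
    have : ∀ v, (σ' v).known = some m := fun v => known_of_mem_support_step hσ' (h v)
    simp [this]
  · rw [Set.indicator_of_mem (show σ ∈ {σ | ¬ ∀ v, (σ v).known = some m} from h)]
    refine expect_le_of_forall_mem_support fun σ' _ => ?_
    exact Set.indicator_le_self' (fun _ _ => zero_le) _

/-- Broadcasting fails by the end of an iteration only if some node does not become active in the
course of that iteration. -/
lemma failureProb_le_sum (P : Fin C → Protocol) (G : Digraph V) (s : V) (m : M) (t : ℕ) :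
    (framework P M).failureProb G s m (2 ^ (t + 2) - 2) ≤
      ∑ v, expect (samples (entry P (2 ^ (t + 1))) (2 ^ (t + 1))) fun l =>
        missProb P (2 ^ (t + 1)) G v l {s} := by
  classical
  have hτ : 2 ^ (t + 2) - 2 = (2 ^ (t + 1) - 2) + 2 ^ (t + 1) := by
    have := Nat.one_le_two_pow (n := t)
    rw [pow_succ, pow_succ]
    omega
  rw [failureProb_eq, hτ, evolve_add, expect_bind]
  refine expect_le_of_forall_mem_support fun σ hσ => ?_
  have h := atStart_of_mem_support_run t σ hσ
  refine le_trans (expect_mono fun σ' => ?_) ((expect_finset_sum _ _ _).le.trans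
    (Finset.sum_le_sum fun v _ => h.expect_evolve_le v))
  by_cases hσ' : ∀ v, (σ' v).known = some m
  · simp [hσ']
  · rw [Set.indicator_of_mem (show σ' ∈ {σ | ¬ ∀ v, (σ v).known = some m} from hσ')]
    obtain ⟨v, hv⟩ := not_forall.1 hσ'
    refine le_trans ?_ (Finset.single_le_sum (fun _ _ => zero_le) (Finset.mem_univ v))
    simp [hv]

end Framework

/-! ### The front on a walk -/

lemma Steps.exists_walk {V : Type} {G : Digraph V} {u : V} :
    ∀ {k : ℕ} {v : V}, Steps G k u v →
      ∃ w : ℕ → V, w 0 = u ∧ w k = v ∧ ∀ i < k, G.Adj (w i) (w (i + 1))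
  | 0, v, h => ⟨fun _ => u, rfl, h, fun _ hi => absurd hi (Nat.not_lt_zero _)⟩
  | k + 1, v, ⟨x, hx, hxv⟩ => by
    obtain ⟨w, h0, hk, hw⟩ := hx.exists_walk
    refine ⟨fun i => if i ≤ k then w i else v, by simp [h0], by simp, fun i hi => ?_⟩
    rcases Nat.lt_succ_iff_lt_or_eq.1 hi with h | rfl
    · simpa [h.le, Nat.succ_le_of_lt h] using hw i h
    · simpa [hk] using hxv

section walk

variable {V : Type}

open Classical in
/-- The last position `i ≤ d` on `w` such that `u` can transmit to `w i`. -/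
def reach (G : Digraph V) (w : ℕ → V) (d : ℕ) (u : V) : ℕ :=
  Nat.findGreatest (fun i => G.Adj u (w i)) d

open Classical in
/-- The number of nodes whose last out-neighbour on `w` is at position `i`. -/
def width [Fintype V] (G : Digraph V) (w : ℕ → V) (d i : ℕ) : ℕ :=
  (Finset.univ.filter fun u => reach G w d u = i).card

/-- Each node has a single value of `reach`, so the classes counted at different positions are
disjoint. -/
lemma sum_width_le [Fintype V] (G : Digraph V) (w : ℕ → V) (d : ℕ) (I : Finset ℕ) :
    ∑ i ∈ I, width G w d i ≤ Fintype.card V := by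
  classical
  unfold width
  rw [← Finset.card_biUnion]
  · exact Finset.card_le_univ _
  · intro i _ j _ hij
    rw [Function.onFun, Finset.disjoint_left]
    intro u hu hu'
    exact hij ((Finset.mem_filter.1 hu).2.symm.trans (Finset.mem_filter.1 hu').2)

open Classical in
/-- The last position `i ≤ d` on `w` such that some node of `A` can transmit to `w i`. -/
def front (G : Digraph V) (w : ℕ → V) (d : ℕ) (A : Set V) : ℕ :=
  Nat.findGreatest (fun i => ∃ u ∈ A, G.Adj u (w i)) d

section front

variable {G : Digraph V} {w : ℕ → V} {d : ℕ} {A B : Set V}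

lemma front_le : front G w d A ≤ d := by
  classical exact Nat.findGreatest_le d

lemma le_front {i : ℕ} (hi : i ≤ d) {u : V} (hu : u ∈ A) (h : G.Adj u (w i)) :
    i ≤ front G w d A := by
  classical exact Nat.le_findGreatest hi ⟨u, hu, h⟩

lemma front_mono (h : A ⊆ B) : front G w d A ≤ front G w d B := by
  classical
  exact Nat.findGreatest_mono_left (fun _ ⟨u, hu, hi⟩ => ⟨u, h hu, hi⟩) d

/-- Excludes the default value `0` of `Nat.findGreatest`, so that the front is a position at which
some active node really can transmit. -/
lemma pos_front (hw : ∀ i < d, G.Adj (w i) (w (i + 1))) (h0 : w 0 ∈ A) (hd : w d ∉ A) :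
    1 ≤ front G w d A := by
  have : 0 < d := Nat.pos_of_ne_zero fun h => hd (h ▸ h0)
  exact le_front this h0 (hw 0 this)

lemma front_lt_of_mem (hw : ∀ i < d, G.Adj (w i) (w (i + 1))) {i : ℕ} (hi : i ≤ d) (hA : w i ∈ A)
    (hd : w d ∉ A) : i < front G w d A := by
  have : i < d := lt_of_le_of_ne hi fun h => hd (h ▸ hA)
  exact le_front this hA (hw i this)

lemma exists_adj_front (hw : ∀ i < d, G.Adj (w i) (w (i + 1))) (h0 : w 0 ∈ A) (hd : w d ∉ A) :
    ∃ u ∈ A, G.Adj u (w (front G w d A)) := by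
  classical
  have h := Nat.findGreatest_of_ne_zero (P := fun i => ∃ u ∈ A, G.Adj u (w i)) (n := d) rfl
    (Nat.one_le_iff_ne_zero.1 (pos_front hw h0 hd))
  exact h

/-- An active node cannot transmit beyond the front. Hence `width` at the front bounds the number of
competing transmitters there. -/
lemma reach_eq_front {u : V} (hu : u ∈ A) (h : G.Adj u (w (front G w d A))) :
    reach G w d u = front G w d A := by
  classical
  refine le_antisymm ?_ (Nat.le_findGreatest front_le h)
  rcases Nat.eq_zero_or_pos (reach G w d u) with h0 | h0
  · omega
  · have := Nat.findGreatest_of_ne_zero (P := fun i => G.Adj u (w i)) (n := d) rfl h0.ne'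
    exact le_front (Nat.findGreatest_le d) hu this

end front

/-! ### The potential -/

open Classical in
/-- The potential of the active set: a product over the positions on `w` from the front on, and
`0` if the end of `w` is active. -/
def potential (G : Digraph V) (w : ℕ → V) (d : ℕ) (r : ℝ) (q : ℕ → ℝ) (A : Set V) : ℝ :=
  if w d ∈ A then 0 else ∏ j ∈ Finset.Ico (front G w d A) (d + 1), (1 - r / q j)⁻¹

section potential

variable {G : Digraph V} {w : ℕ → V} {d : ℕ} {r : ℝ} {q : ℕ → ℝ}

lemma ratio_le_half (hr : 0 < r) {x : ℝ} (hx : 2 * r ≤ x) : r / x ≤ 1 / 2 := by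
  rw [div_le_div_iff₀ (by linarith) (by norm_num)]
  linarith

lemma one_le_factor (hr : 0 < r) {x : ℝ} (hx : 2 * r ≤ x) : 1 ≤ (1 - r / x)⁻¹ := by
  have h1 := ratio_le_half hr hx
  have h2 : 0 ≤ r / x := div_nonneg hr.le (by linarith)
  exact (one_le_inv₀ (by linarith)).2 (by linarith)

/-- For `0 ≤ y ≤ 1/2`, `(1 - y)⁻¹ ≤ 1 + 2 * y ≤ exp (2 * y)`. -/
lemma factor_le_exp (hr : 0 < r) {x : ℝ} (hx : 2 * r ≤ x) :
    (1 - r / x)⁻¹ ≤ Real.exp (2 * r * (1 / x)) := by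
  have h1 := ratio_le_half hr hx
  have h2 : 0 ≤ r / x := div_nonneg hr.le (by linarith)
  have h3 : 2 * r * (1 / x) = 2 * (r / x) := by ring
  rw [h3]
  refine le_trans ?_ (Real.add_one_le_exp _)
  rw [inv_le_iff_one_le_mul₀ (by linarith)]
  nlinarith

lemma potential_nonneg (hr : 0 < r) (hq : ∀ i ∈ Finset.Icc 1 d, 2 * r ≤ q i)
    (hw : ∀ i < d, G.Adj (w i) (w (i + 1))) {A : Set V} (h0 : w 0 ∈ A) :
    0 ≤ potential G w d r q A := by
  unfold potential
  split_ifs with hd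
  · exact le_rfl
  · refine Finset.prod_nonneg fun j hj => zero_le_one.trans (one_le_factor hr (hq j ?_))
    have := pos_front hw h0 hd
    simp only [Finset.mem_Ico, Finset.mem_Icc] at hj ⊢
    omega

lemma one_le_potential (hr : 0 < r) (hq : ∀ i ∈ Finset.Icc 1 d, 2 * r ≤ q i)
    (hw : ∀ i < d, G.Adj (w i) (w (i + 1))) {A : Set V} (h0 : w 0 ∈ A) (hd : w d ∉ A) :
    1 ≤ potential G w d r q A := by
  rw [potential, if_neg hd]
  refine Finset.one_le_prod fun j => ?_
  intro hj
  refine one_le_factor hr (hq j ?_)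
  have := pos_front hw h0 hd
  simp only [Finset.mem_Ico, Finset.mem_Icc] at hj ⊢
  omega

lemma potential_le_exp (hr : 0 < r) (hq : ∀ i ∈ Finset.Icc 1 d, 2 * r ≤ q i)
    (hw : ∀ i < d, G.Adj (w i) (w (i + 1))) {A : Set V} (h0 : w 0 ∈ A) :
    potential G w d r q A ≤ Real.exp (2 * r * ∑ i ∈ Finset.Icc 1 d, 1 / q i) := by
  unfold potential
  split_ifs with hd
  · positivity
  · have hf := pos_front hw h0 hd
    have hsub : Finset.Ico (front G w d A) (d + 1) ⊆ Finset.Icc 1 d := by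
      intro j
      simp only [Finset.mem_Ico, Finset.mem_Icc]
      omega
    rw [Finset.mul_sum, Real.exp_sum]
    calc _ ≤ ∏ j ∈ Finset.Ico (front G w d A) (d + 1), Real.exp (2 * r * (1 / q j)) :=
          Finset.prod_le_prod
            (fun j hj => zero_le_one.trans (one_le_factor hr (hq j (hsub hj))))
            (fun j hj => factor_le_exp hr (hq j (hsub hj)))
      _ ≤ _ := by
          refine Finset.prod_le_prod_of_subset_of_one_le hsub (fun j _ => (Real.exp_pos _).le) ?_
          intro j hj _
          have := hq j hj
          exact Real.one_le_exp (mul_nonneg (by linarith) (one_div_nonneg.2 (by linarith)))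

lemma potential_antitone (hr : 0 < r) (hq : ∀ i ∈ Finset.Icc 1 d, 2 * r ≤ q i)
    (hw : ∀ i < d, G.Adj (w i) (w (i + 1))) {A B : Set V} (h0 : w 0 ∈ A) (hAB : A ⊆ B) :
    potential G w d r q B ≤ potential G w d r q A := by
  by_cases hB : w d ∈ B
  · rw [potential, if_pos hB]
    exact potential_nonneg hr hq hw h0
  · have hA : w d ∉ A := fun h => hB (hAB h)
    rw [potential, if_neg hB, potential, if_neg hA]
    have hpos := pos_front hw h0 hA
    have hfac : ∀ j ∈ Finset.Ico (front G w d A) (d + 1), 1 ≤ (1 - r / q j)⁻¹ := by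
      intro j hj
      refine one_le_factor hr (hq j ?_)
      simp only [Finset.mem_Ico, Finset.mem_Icc] at hj ⊢
      omega
    have hsub : Finset.Ico (front G w d B) (d + 1) ⊆ Finset.Ico (front G w d A) (d + 1) :=
      Finset.Ico_subset_Ico_left (front_mono hAB)
    exact Finset.prod_le_prod_of_subset_of_one_le hsub
      (fun j hj => zero_le_one.trans (hfac j (hsub hj))) (fun j hj _ => hfac j hj)

/-- Once the front node is active it can transmit to its successor on `w`, so the front moves past
it and at least its factor drops out; if the end of `w` is active, the potential is `0`. -/
lemma potential_le_of_mem (hr : 0 < r) (hq : ∀ i ∈ Finset.Icc 1 d, 2 * r ≤ q i)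
    (hw : ∀ i < d, G.Adj (w i) (w (i + 1))) {A B : Set V} (h0 : w 0 ∈ A) (hd : w d ∉ A)
    (hB : w (front G w d A) ∈ B) :
    potential G w d r q B ≤ (1 - r / q (front G w d A)) * potential G w d r q A := by
  have hpos := pos_front hw h0 hd
  have hle : front G w d A ≤ d := front_le
  have hi := hq (front G w d A) (Finset.mem_Icc.2 ⟨hpos, hle⟩)
  have hhalf := ratio_le_half hr hi
  by_cases hBd : w d ∈ B
  · rw [potential, if_pos hBd]
    exact mul_nonneg (by linarith) (potential_nonneg hr hq hw h0)
  · have hlt := front_lt_of_mem hw hle hB hBd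
    rw [potential, if_neg hBd, potential, if_neg hd, Finset.prod_eq_prod_Ico_succ_bot (Nat.lt_succ_of_le hle),
      ← mul_assoc, mul_inv_cancel₀ (by linarith), one_mul]
    have hfac : ∀ j ∈ Finset.Ico (front G w d A + 1) (d + 1), 1 ≤ (1 - r / q j)⁻¹ := by
      intro j hj
      refine one_le_factor hr (hq j ?_)
      simp only [Finset.mem_Ico, Finset.mem_Icc] at hj ⊢
      omega
    have hsub : Finset.Ico (front G w d B) (d + 1) ⊆ Finset.Ico (front G w d A + 1) (d + 1) :=
      Finset.Ico_subset_Ico_left hlt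
    exact Finset.prod_le_prod_of_subset_of_one_le hsub
      (fun j hj => zero_le_one.trans (hfac j (hsub hj))) (fun j hj _ => hfac j hj)

end potential

open Classical in
/-- The probability that in a random time-step exactly one node of `N` would transmit. -/
def hitProb [Fintype V] {C : ℕ} (P : Fin C → Protocol) (T : ℕ) (p : PMF (Fin C × ℕ))
    (N : Finset V) : ℝ≥0∞ :=
  expect p fun e => expect (entryCoins P T V e) fun b => if ∃! u, u ∈ N ∧ b u = true then 1 else 0

/-- With probability at least `q i` the potential loses the fraction `r / q i`. The `q i` cancel,
which is why the factors have this form: the expected loss is the fraction `r` at every front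
position. -/
lemma expect_potential_spread_le [Fintype V] {C : ℕ} {P : Fin C → Protocol} {T : ℕ}
    {p : PMF (Fin C × ℕ)} {G : Digraph V} {w : ℕ → V} {d : ℕ} {r : ℝ} {q : ℕ → ℝ}
    (hr : 0 < r) (hq : ∀ i ∈ Finset.Icc 1 d, 2 * r ≤ q i)
    (hw : ∀ i < d, G.Adj (w i) (w (i + 1)))
    (hhit : ∀ i ∈ Finset.Icc 1 d, ∀ N : Finset V, N.Nonempty → N.card ≤ width G w d i →
      ENNReal.ofReal (q i) ≤ hitProb P T p N) {A : Set V} (h0 : w 0 ∈ A) :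
    (expect p fun e => expect (entryCoins P T V e) fun b =>
        ENNReal.ofReal (potential G w d r q (spread G A b))) ≤
      ENNReal.ofReal (1 - r) * ENNReal.ofReal (potential G w d r q A) := by
  classical
  by_cases hd : w d ∈ A
  · have : ∀ b, potential G w d r q (spread G A b) = 0 := fun b => if_pos (Or.inl hd)
    simp [this, expect_const]
  set i := front G w d A with hi
  set h := potential G w d r q A with hh
  have hi1 : i ∈ Finset.Icc 1 d := Finset.mem_Icc.2 ⟨pos_front hw h0 hd, front_le⟩
  have hqi := hq i hi1
  have hh0 : 0 ≤ h := potential_nonneg hr hq hw h0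
  have hqpos : 0 < q i := by linarith
  set N : Finset V := Finset.univ.filter fun u => u ∈ A ∧ G.Adj u (w i) with hN
  have hNne : N.Nonempty := by
    obtain ⟨u, hu, ha⟩ := exists_adj_front hw h0 hd
    exact ⟨u, by simpa [hN] using ⟨hu, ha⟩⟩
  have hNcard : N.card ≤ width G w d i := by
    refine Finset.card_le_card fun u hu => ?_
    simp only [hN, Finset.mem_filter, Finset.mem_univ, true_and] at hu ⊢
    exact reach_eq_front hu.1 hu.2
  -- The loss is kept on the left-hand side to avoid truncated subtraction.
  have key : ∀ b, ENNReal.ofReal (potential G w d r q (spread G A b)) +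
      ENNReal.ofReal (h * (r / q i)) * (if ∃! u, u ∈ N ∧ b u = true then 1 else 0) ≤
        ENNReal.ofReal h := by
    intro b
    have hsub : A ⊆ spread G A b := fun _ hx => Or.inl hx
    split_ifs with hex
    · have hmem : w i ∈ spread G A b := by
        refine Or.inr ?_
        obtain ⟨u, hu, huniq⟩ := hex
        simp only [hN, Finset.mem_filter, Finset.mem_univ, true_and] at hu huniq
        exact ⟨u, ⟨hu.1.2, hu.1.1, hu.2⟩, fun y hy => huniq y ⟨⟨hy.2.1, hy.1⟩, hy.2.2⟩⟩
      have := potential_le_of_mem hr hq hw h0 hd hmem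
      rw [mul_one, ← ENNReal.ofReal_add (potential_nonneg hr hq hw (hsub h0)) (by positivity)]
      refine ENNReal.ofReal_le_ofReal ?_
      rw [← hi, ← hh] at this
      linarith
    · rw [mul_zero, add_zero]
      exact ENNReal.ofReal_le_ofReal (potential_antitone hr hq hw h0 hsub)
  have hsum : (expect p fun e => expect (entryCoins P T V e) fun b =>
        ENNReal.ofReal (potential G w d r q (spread G A b))) +
      ENNReal.ofReal (h * (r / q i)) * hitProb P T p N ≤ ENNReal.ofReal h := by
    rw [hitProb, ← expect_const_mul, ← expect_add]
    simp only [← expect_const_mul, ← expect_add]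
    refine (expect_mono fun e => expect_mono fun b => key b).trans_eq ?_
    simp only [expect_const]
  have hprod : ENNReal.ofReal (h * r) ≤ ENNReal.ofReal (h * (r / q i)) * hitProb P T p N := by
    calc ENNReal.ofReal (h * r) = ENNReal.ofReal (h * (r / q i)) * ENNReal.ofReal (q i) := by
          rw [← ENNReal.ofReal_mul (by positivity)]
          congr 1
          field_simp
      _ ≤ _ := by gcongr; exact hhit i hi1 N hNne hNcard
  rw [← ENNReal.ofReal_mul' hh0, show (1 - r) * h = h - h * r by ring,
    ENNReal.ofReal_sub _ (by positivity)]
  refine ENNReal.le_sub_of_add_le_right ENNReal.ofReal_ne_top ?_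
  exact le_trans (by gcongr) hsum

/-- The probability that the end of a walk stays inactive, in terms of lower bounds `q i` on the
probabilities of progress. -/
lemma expect_missProb_le_exp [Fintype V] {C : ℕ} {P : Fin C → Protocol} {T : ℕ}
    {p : PMF (Fin C × ℕ)} {G : Digraph V} {w : ℕ → V} {d : ℕ} {r : ℝ} {q : ℕ → ℝ}
    (hr : 0 < r) (hr1 : r ≤ 1) (hq : ∀ i ∈ Finset.Icc 1 d, 2 * r ≤ q i)
    (hw : ∀ i < d, G.Adj (w i) (w (i + 1)))
    (hhit : ∀ i ∈ Finset.Icc 1 d, ∀ N : Finset V, N.Nonempty → N.card ≤ width G w d i →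
      ENNReal.ofReal (q i) ≤ hitProb P T p N) (k : ℕ) :
    (expect (samples p k) fun l => missProb P T G (w d) l {w 0}) ≤
      ENNReal.ofReal (Real.exp (2 * r * ∑ i ∈ Finset.Icc 1 d, 1 / q i - r * k)) := by
  refine (expect_missProb_le P T G (w 0) (w d) p
    (fun A => ENNReal.ofReal (potential G w d r q A)) (ENNReal.ofReal (1 - r))
    (fun A h0 hd => ?_) (fun A h0 => expect_potential_spread_le hr hq hw hhit h0) k {w 0} rfl).trans ?_
  · rw [← ENNReal.ofReal_one]
    exact ENNReal.ofReal_le_ofReal (one_le_potential hr hq hw h0 hd)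
  · rw [← ENNReal.ofReal_pow (by linarith), ← ENNReal.ofReal_mul (by positivity)]
    refine ENNReal.ofReal_le_ofReal ?_
    rw [sub_eq_add_neg (2 * r * _), Real.exp_add, mul_comm]
    refine mul_le_mul (potential_le_exp hr hq hw rfl) ?_
      (pow_nonneg (by linarith) _) (Real.exp_pos _).le
    calc (1 - r) ^ k ≤ Real.exp (-r) ^ k :=
          pow_le_pow_left₀ (by linarith) (Real.one_sub_le_exp_neg r) k
      _ = Real.exp (-(r * k)) := by rw [← Real.exp_nat_mul]; congr 1; ring

end walk

/-! ### Probabilities of progress -/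

/-- The exponent that suits `m` competing transmitters. -/
def bits (m : ℕ) : ℕ := max 1 (Nat.clog 2 m)

lemma one_le_bits (m : ℕ) : 1 ≤ bits m := le_max_left _ _

lemma bits_mono : Monotone bits := fun _ _ h => max_le_max le_rfl (Nat.clog_mono_right 2 h)

lemma le_two_pow_bits (m : ℕ) : m ≤ 2 ^ bits m :=
  (Nat.le_pow_clog (by norm_num) m).trans (Nat.pow_le_pow_right (by norm_num) (le_max_right _ _))

lemma two_pow_bits_le {m : ℕ} (hm : 1 ≤ m) : 2 ^ bits m ≤ 2 * m := by
  rcases le_or_gt (Nat.clog 2 m) 1 with h | h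
  · rw [bits, max_eq_left h]
    omega
  · rw [bits, max_eq_right h.le]
    have h2 : 2 ^ (Nat.clog 2 m - 1) < m := Nat.pow_pred_clog_lt_self (by norm_num) (by
      by_contra hm'
      have : m = 1 := by omega
      simp [this] at h)
    have h3 : 2 ^ Nat.clog 2 m = 2 * 2 ^ (Nat.clog 2 m - 1) := by
      rw [← pow_succ']
      congr 1
      omega
    omega

/-- With `p = 2 ^ (-bits k)`, `k p ≥ 1/2` because `2 ^ bits k ≤ 2 k`, and `(1 - p) ^ (1 / p) ≥ 1/4`
by squaring Bernoulli's inequality for the exponent `1 / (2 p)`. -/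
lemma one_eighth_le_hit {k : ℕ} (hk : 1 ≤ k) :
    (1 / 8 : ℝ) ≤ k * ((1 / 2) ^ bits k * (1 - (1 / 2) ^ bits k) ^ (k - 1)) := by
  obtain ⟨y, hy⟩ : ∃ y, bits k = y + 1 := Nat.exists_eq_add_of_le' (one_le_bits k)
  have hp0 : (0 : ℝ) < (1 / 2) ^ bits k := by positivity
  have hp1 : ((1 / 2) ^ bits k : ℝ) ≤ 1 := pow_le_one₀ (by norm_num) (by norm_num)
  have hmul : ((2 ^ bits k : ℕ) : ℝ) * (1 / 2) ^ bits k = 1 := by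
    push_cast
    rw [← mul_pow]
    norm_num
  have h1 : (1 / 2 : ℝ) ≤ k * (1 / 2) ^ bits k := by
    have : ((2 ^ bits k : ℕ) : ℝ) ≤ 2 * k := by exact_mod_cast two_pow_bits_le hk
    nlinarith
  have h2 : (1 / 4 : ℝ) ≤ (1 - (1 / 2) ^ bits k) ^ (k - 1) := by
    have hb : (1 / 2 : ℝ) ≤ (1 - (1 / 2) ^ bits k) ^ (2 ^ y) := by
      have hbern := one_add_mul_le_pow (a := -((1 / 2 : ℝ) ^ bits k)) (by linarith) (2 ^ y)
      have : ((2 ^ y : ℕ) : ℝ) * (1 / 2) ^ bits k = 1 / 2 := by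
        rw [hy, pow_succ (2 : ℕ)] at hmul
        rw [hy]
        push_cast at hmul ⊢
        linarith
      rw [← sub_eq_add_neg] at hbern
      linarith
    calc (1 / 4 : ℝ) ≤ ((1 - (1 / 2) ^ bits k) ^ (2 ^ y)) ^ 2 := by nlinarith
      _ = (1 - (1 / 2) ^ bits k) ^ (2 ^ bits k) := by rw [← pow_mul, hy, ← pow_succ]
      _ ≤ _ := pow_le_pow_of_le_one (by linarith) (by linarith)
          ((Nat.sub_le _ _).trans (le_two_pow_bits k))
  have h3 : (1 / 8 : ℝ) ≤ (k * (1 / 2) ^ bits k) * (1 - (1 / 2) ^ bits k) ^ (k - 1) := by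
    nlinarith
  linarith

/-- Keeps only the outcome in which protocol `i` is chosen and guesses exactly `bits N.card`. -/
lemma le_hitProb_entry {V : Type} [Fintype V] {C : ℕ} [NeZero C] (P : Fin C → Protocol) (T : ℕ)
    (i : Fin C) (N : Finset V) (hN : N.Nonempty)
    (hP : (P i).prob T (bits N.card) = (1 / 2) ^ bits N.card) :
    (C : ℝ≥0∞)⁻¹ * ((P i).guess T (bits N.card) * ENNReal.ofReal (1 / 8)) ≤
      hitProb P T (Framework.entry P T) N := by
  rw [hitProb, Framework.entry, expect_bind]
  refine le_trans ?_ (mul_le_expect _ _ i)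
  rw [PMF.uniformOfFintype_apply, Fintype.card_fin, expect_map]
  refine mul_le_mul_right (le_trans ?_ (mul_le_expect _ _ (bits N.card))) _
  refine mul_le_mul_right (le_trans ?_ (expect_coins_existsUnique _ _ N)) _
  rw [ENNReal.ofReal, ENNReal.coe_le_coe, Real.toNNReal_le_iff_le_coe]
  simp only [hP]
  have := one_eighth_le_hit hN.card_pos
  have hp1 : ((1 / 2 : ℝ≥0) ^ bits N.card) ≤ 1 := pow_le_one' (by norm_num) _
  rw [NNReal.coe_mul, NNReal.coe_mul, NNReal.coe_pow, NNReal.coe_pow, NNReal.coe_sub hp1]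
  push_cast
  exact this

/-- The inverse of a lower bound on the probability with which General-Broadcast makes progress
at a node with at most `m` active in-neighbours. -/
def cost (m : ℕ) : ℝ := 48 * bits m * log (bits m) ^ 2

lemma one_le_log (x : ℝ) : 1 ≤ log x := le_max_right _ _

lemma log_mono {x y : ℝ} (hx : 0 ≤ x) (h : x ≤ y) : log x ≤ log y := by
  rcases hx.eq_or_lt with rfl | hx
  · simp [log]
  · exact max_le_max (Real.logb_le_logb_of_le (by norm_num) hx h) le_rfl

lemma one_le_cast_bits (m : ℕ) : (1 : ℝ) ≤ bits m := by exact_mod_cast one_le_bits m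

lemma cost_mono {m k : ℕ} (h : m ≤ k) : cost m ≤ cost k := by
  have h1 : (bits m : ℝ) ≤ bits k := by exact_mod_cast bits_mono h
  have h2 := log_mono (Nat.cast_nonneg _) h1
  have h3 := one_le_log (bits m)
  unfold cost
  gcongr

lemma one_le_cost (m : ℕ) : 1 ≤ cost m := by
  have h1 := one_le_cast_bits m
  have h2 : 1 ≤ log (bits m) ^ 2 := one_le_pow₀ (one_le_log _)
  unfold cost
  nlinarith

/-- The two protocols of the algorithm. -/
abbrev protocols (c : ℝ) : Fin 2 → Protocol := ![shallowBroadcast c, generalBroadcast]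

/-- Here `16 = 2 * 8`: one half for the choice of the protocol, one eighth for a single transmitter
given the right guess. The `48` in `cost` is this times the `3` of General-Broadcast. -/
lemma shallow_le_hitProb {V : Type} [Fintype V] {T : ℕ} (N : Finset V)
    (hN : N.Nonempty) (hT : (bits N.card : ℝ) ≤ √T) :
    ENNReal.ofReal (1 / (16 * √T)) ≤
      hitProb (protocols 1) T (Framework.entry (protocols 1) T) N := by
  refine le_trans (le_of_eq ?_) (le_hitProb_entry (protocols 1) T 0 N hN rfl)
  have hg : ((protocols 1) 0).guess T (bits N.card) = ENNReal.ofReal (1 / √T) := by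
    change (if bits N.card = 0 then _ else shallowWeight 1 T (bits N.card)) = _
    have h1 := one_le_bits N.card
    rw [if_neg (by omega), shallowWeight, if_pos ⟨h1, Nat.le_floor (by simpa using hT)⟩]
  rw [hg, ← ENNReal.ofReal_natCast, ← ENNReal.ofReal_inv_of_pos (by norm_num),
    ← ENNReal.ofReal_mul (by positivity), ← ENNReal.ofReal_mul (by positivity)]
  congr 1
  push_cast
  field_simp
  norm_num

lemma general_le_hitProb {V : Type} [Fintype V] (c : ℝ) (T : ℕ) {m : ℕ} (N : Finset V)
    (hN : N.Nonempty) (hm : N.card ≤ m) :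
    ENNReal.ofReal (1 / cost m) ≤
      hitProb (protocols c) T (Framework.entry (protocols c) T) N := by
  refine le_trans ?_ (le_hitProb_entry (protocols c) T 1 N hN rfl)
  have hg : ((protocols c) 1).guess T (bits N.card) =
      ENNReal.ofReal (1 / (3 * bits N.card * log (bits N.card) ^ 2)) := by
    change (if bits N.card = 0 then _ else generalWeight (bits N.card)) = _
    have h1 := one_le_bits N.card
    rw [if_neg (by omega), generalWeight]
  rw [hg, ← ENNReal.ofReal_natCast, ← ENNReal.ofReal_inv_of_pos (by norm_num),
    ← ENNReal.ofReal_mul (by positivity), ← ENNReal.ofReal_mul (by positivity)]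
  refine ENNReal.ofReal_le_ofReal ?_
  calc 1 / cost m ≤ 1 / cost N.card :=
        one_div_le_one_div_of_le (zero_lt_one.trans_le (one_le_cost _)) (cost_mono hm)
    _ = _ := by
        have := one_le_cast_bits N.card
        have := one_le_log (bits N.card)
        unfold cost
        push_cast
        field_simp
        norm_num

/-! ### Estimates of the logarithms -/

/-- A sum of two numbers that are at least `1` is at most twice their product. The product form lets
the factors in `cost_le` separate. -/
lemma log_mul_le {x y : ℝ} (hx : 0 < x) (hy : 0 < y) : log (x * y) ≤ 2 * log x * log y := by
  have h1 := one_le_log x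
  have h2 := one_le_log y
  refine max_le ?_ (by nlinarith)
  rw [Real.logb_mul hx.ne' hy.ne']
  have h3 : Real.logb 2 x ≤ log x := le_max_left _ _
  have h4 : Real.logb 2 y ≤ log y := le_max_left _ _
  nlinarith

lemma log_two : log 2 = 1 := by simp [log]

lemma log_four : log 4 = 2 := by
  have : Real.logb 2 4 = 2 := by
    rw [show (4 : ℝ) = 2 ^ (2 : ℝ) by norm_num, Real.logb_rpow] <;> norm_num
  rw [log, this]
  norm_num

lemma log_le_self {x : ℝ} (hx : 1 ≤ x) : log x ≤ x := by
  refine max_le ?_ hx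
  rw [Real.logb_le_iff_le_rpow (by norm_num) (by linarith)]
  have h1 : x < (⌊x⌋₊ : ℝ) + 1 := Nat.lt_floor_add_one x
  have h2 : ((⌊x⌋₊ : ℝ) + 1) ≤ 2 ^ (⌊x⌋₊ : ℝ) := by
    rw [Real.rpow_natCast]
    exact_mod_cast Nat.lt_two_pow_self (n := ⌊x⌋₊)
  have h3 : (2 : ℝ) ^ (⌊x⌋₊ : ℝ) ≤ 2 ^ x :=
    Real.rpow_le_rpow_of_exponent_le (by norm_num) (Nat.floor_le (by linarith))
  linarith

lemma log_le_two_mul_log_sqrt {x : ℝ} (hx : 0 < x) : log x ≤ 2 * log √x := by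
  have h1 := one_le_log √x
  refine max_le ?_ (by linarith)
  have h2 : Real.logb 2 √x ≤ log √x := le_max_left _ _
  have h3 : Real.logb 2 x = 2 * Real.logb 2 √x := by
    conv_lhs => rw [← Real.sq_sqrt hx.le]
    rw [Real.logb_pow]
    norm_num
  linarith

lemma log_sq_le {x : ℝ} (hx : 1 ≤ x) : log x ^ 2 ≤ 4 * x := by
  have h1 := log_le_two_mul_log_sqrt (zero_lt_one.trans_le hx)
  have h2 := log_le_self (Real.one_le_sqrt.2 hx)
  have h3 := one_le_log x
  calc log x ^ 2 ≤ (2 * √x) ^ 2 := pow_le_pow_left₀ (by linarith) (by linarith) 2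
    _ = 4 * x := by rw [mul_pow, Real.sq_sqrt (by linarith)]; norm_num

lemma log_max_one {x : ℝ} (hx : 0 ≤ x) : log (max x 1) = log x := by
  rcases le_total x 1 with h | h
  · have : Real.logb 2 x ≤ 0 := Real.logb_nonpos (by norm_num) hx h
    rw [max_eq_right h, log, log, Real.logb_one, max_eq_right zero_le_one,
      max_eq_right (by linarith)]
  · rw [max_eq_left h]

lemma bits_le (m : ℕ) : (bits m : ℝ) ≤ 2 * log m := by
  have h1 := one_le_log m
  rcases le_or_gt (Nat.clog 2 m) 1 with h | h
  · rw [bits, max_eq_left h, Nat.cast_one]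
    linarith
  · have hm : 1 < m := by
      by_contra hm
      have : Nat.clog 2 m = 0 := Nat.clog_of_right_le_one (by omega) 2
      omega
    have h2 : 2 ^ (Nat.clog 2 m - 1) < m := Nat.pow_pred_clog_lt_self (by norm_num) hm
    have h3 : ((Nat.clog 2 m - 1 : ℕ) : ℝ) ≤ Real.logb 2 m := by
      rw [Real.le_logb_iff_rpow_le (by norm_num) (by exact_mod_cast (by omega : 0 < m)),
        Real.rpow_natCast]
      exact_mod_cast h2.le
    have h4 : Real.logb 2 m ≤ log m := le_max_left _ _
    rw [Nat.cast_sub (by omega)] at h3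
    rw [bits, max_eq_right h.le]
    push_cast at h3
    linarith

lemma cost_le_mul_log (m : ℕ) : cost m ≤ 384 * (log m * log (log m) ^ 2) := by
  have h1 := bits_le m
  have h2 := one_le_log m
  have h3 : log (bits m) ≤ 2 * log (log m) := by
    refine (log_mono (Nat.cast_nonneg _) h1).trans ((log_mul_le (by norm_num) (by linarith)).trans ?_)
    rw [log_two, mul_one]
  have h4 := one_le_log (bits m)
  calc cost m ≤ 48 * (2 * log m) * (2 * log (log m)) ^ 2 := by unfold cost; gcongr
    _ = _ := by ring

/-- A linear majorant in `m`, in place of a concavity argument. Writing `m ≤ a * u` splits the cost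
into the desired factor in `a` and a polylogarithm of `u`, which is `O(u)`. -/
lemma cost_le {a : ℝ} (ha : 1 ≤ a) (m : ℕ) :
    cost m ≤ 196608 * (log a * log (log a) ^ 2) * (1 + m / a) := by
  set u : ℝ := max (m / a) 1 with hu
  have hu1 : 1 ≤ u := le_max_right _ _
  have hma : 0 ≤ m / a := by positivity
  have huu : u ≤ 1 + m / a := max_le (by linarith) (by linarith)
  have hmau : (m : ℝ) ≤ a * u := by
    have : m / a ≤ u := le_max_left _ _
    rwa [div_le_iff₀' (by linarith)] at this
  have hL := one_le_log a
  have hLL := one_le_log (log a)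
  have hU := one_le_log u
  have hUU := one_le_log (log u)
  have h1 : (bits m : ℝ) ≤ 4 * (log a * log u) := by
    have := log_mono (Nat.cast_nonneg m) hmau
    have := log_mul_le (by linarith : 0 < a) (by linarith : 0 < u)
    have := bits_le m
    linarith
  have h2 : log (bits m) ≤ 8 * (log (log a) * log (log u)) := by
    have e1 := log_mono (Nat.cast_nonneg _) h1
    have e2 := log_mul_le (by norm_num : (0 : ℝ) < 4) (by positivity : 0 < log a * log u)
    have e3 := log_mul_le (by linarith : 0 < log a) (by linarith : 0 < log u)
    rw [log_four] at e2
    linarith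
  have h3 : log u * log (log u) ^ 2 ≤ 16 * u := by
    have e1 := log_sq_le hU
    have e2 := log_sq_le hu1
    nlinarith
  have h4 := one_le_log (bits m)
  calc cost m ≤ 48 * (4 * (log a * log u)) * (8 * (log (log a) * log (log u))) ^ 2 := by
        unfold cost; gcongr
    _ = 12288 * (log a * log (log a) ^ 2) * (log u * log (log u) ^ 2) := by ring
    _ ≤ 12288 * (log a * log (log a) ^ 2) * (16 * u) := by gcongr
    _ = 196608 * (log a * log (log a) ^ 2) * u := by ring
    _ ≤ _ := by gcongr

/-- Take `a` to be the average `n / D`, truncated at `1` (which `log` does not notice): then the sum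
of `1 + f i / a` is at most `D + n / a ≤ 2 * D`. -/
lemma sum_cost_le {n D : ℕ} (hD : 1 ≤ D) {d : ℕ} (hd : d ≤ D) (f : ℕ → ℕ)
    (hf : ∑ i ∈ Finset.Icc 1 d, f i ≤ n) :
    ∑ i ∈ Finset.Icc 1 d, cost (f i) ≤
      393216 * (D * log (n / D) * log (log (n / D)) ^ 2) := by
  have hD' : (0 : ℝ) < D := by exact_mod_cast hD
  set a : ℝ := max (n / D) 1 with ha
  have ha1 : 1 ≤ a := le_max_right _ _
  have hlog : log a = log (n / D) := log_max_one (by positivity)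
  have hna : (n : ℝ) / a ≤ D := by
    have : (n : ℝ) / D ≤ a := le_max_left _ _
    rw [div_le_iff₀ (by linarith)]
    rwa [div_le_iff₀' hD'] at this
  have hL := one_le_log a
  calc ∑ i ∈ Finset.Icc 1 d, cost (f i)
      ≤ ∑ i ∈ Finset.Icc 1 d, 196608 * (log a * log (log a) ^ 2) * (1 + f i / a) :=
        Finset.sum_le_sum fun i _ => cost_le ha1 _
    _ = 196608 * (log a * log (log a) ^ 2) * (d + (∑ i ∈ Finset.Icc 1 d, f i : ℕ) / a) := by
        rw [← Finset.mul_sum, Finset.sum_add_distrib, ← Finset.sum_div]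
        simp
    _ ≤ 196608 * (log a * log (log a) ^ 2) * (D + n / a) := by gcongr
    _ ≤ 196608 * (log a * log (log a) ^ 2) * (D + D) := by gcongr
    _ = _ := by rw [hlog]; ring

lemma half_log_le {x y : ℝ} (hx : 0 < x) (hy : x / 2 ≤ y) : log x / 2 ≤ log y := by
  have h1 := one_le_log y
  have h2 : Real.logb 2 x - 1 ≤ log y := by
    refine le_trans (le_of_eq ?_) ((le_max_left _ _).trans (log_mono (by positivity) hy))
    rw [Real.logb_div hx.ne' (by norm_num), Real.logb_self_eq_one (by norm_num)]
  have h3 : log x ≤ 2 * log y := max_le (by linarith) (by linarith)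
  linarith

/-- If the eccentricity is at least of the order of `√T`, then `T` is large enough for the rarest
guesses to appear often. -/
lemma log_sq_mul_le_of_timeBound_le {n D : ℕ} (hn : 1 ≤ n) {T : ℝ}
    (hT : 2 ^ 24 * timeBound n D ≤ T) (hD : √T / 64 < D) :
    3072 * (log n ^ 2 * log (log n) ^ 2) ≤ T := by
  have hn' : (1 : ℝ) ≤ n := by exact_mod_cast hn
  set L := log (n / D) with hL
  set ℓ := log L with hℓ
  set x := log n with hx
  have hx1 : 1 ≤ x := one_le_log _
  have hL1 : 1 ≤ L := one_le_log _
  have hℓ1 : 1 ≤ ℓ := one_le_log _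
  have hy1 : 1 ≤ log x := one_le_log _
  have hD0 : (0 : ℝ) < D := lt_of_le_of_lt (by positivity) hD
  have hT' : 2 ^ 24 * (D * L * ℓ ^ 2 + x ^ 2) ≤ T := hT
  have hA : 2 ^ 24 * (D * L * ℓ ^ 2) ≤ T := by nlinarith
  have hDx : 64 * x ≤ D := by
    have : 4096 * x ≤ √T := by
      refine Real.le_sqrt_of_sq_le ?_
      have : 0 ≤ D * L * ℓ ^ 2 := by positivity
      nlinarith
    linarith
  -- If `D ≤ √n`, then `n / D ≥ √n`, so `L` is at least half of `log n`, and `D ≥ 64 * log n`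
  -- supplies the second logarithm. Otherwise `D` is polynomial in `n` and beats every
  -- polylogarithm.
  rcases le_or_gt (D : ℝ) √n with h | h
  · have hLx : x / 2 ≤ L := by
      have h1 := log_le_two_mul_log_sqrt (zero_lt_one.trans_le hn')
      have h2 : log √n ≤ L := by
        refine log_mono (Real.sqrt_nonneg _) ?_
        rw [le_div_iff₀ hD0]
        calc √n * D ≤ √n * √n := by gcongr
          _ = n := Real.mul_self_sqrt (by linarith)
      linarith
    have hℓx : log x / 2 ≤ ℓ := half_log_le (by linarith) hLx
    calc 3072 * (x ^ 2 * log x ^ 2) ≤ 2 ^ 24 * ((64 * x) * (x / 2) * (log x / 2) ^ 2) := by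
          have : 0 ≤ x ^ 2 * log x ^ 2 := by positivity
          nlinarith
      _ ≤ 2 ^ 24 * (D * L * ℓ ^ 2) := by gcongr
      _ ≤ T := hA
  · have hs1 : 1 ≤ √(n : ℝ) := Real.one_le_sqrt.2 hn'
    have hs2 : 1 ≤ √√(n : ℝ) := Real.one_le_sqrt.2 hs1
    -- `z` is the eighth root of `n`: then `log n ≤ 8 * z`, and a cube of `log n` stays below a
    -- multiple of `z ^ 4 = √n`.
    set z := √√√(n : ℝ) with hz
    have hz1 : 1 ≤ z := Real.one_le_sqrt.2 hs2
    have hz4 : z ^ 4 = √n := by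
      rw [show z ^ 4 = (z ^ 2) ^ 2 by ring, hz, Real.sq_sqrt (by linarith),
        Real.sq_sqrt (by linarith)]
    have hxz : x ≤ 8 * z := by
      have e1 := log_le_two_mul_log_sqrt (zero_lt_one.trans_le hn')
      have e2 := log_le_two_mul_log_sqrt (zero_lt_one.trans_le hs1)
      have e3 := log_le_two_mul_log_sqrt (zero_lt_one.trans_le hs2)
      have e4 := log_le_self hz1
      linarith
    calc 3072 * (x ^ 2 * log x ^ 2) ≤ 3072 * (x ^ 2 * (4 * x)) := by
          gcongr; exact log_sq_le hx1
      _ = 12288 * x ^ 3 := by ring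
      _ ≤ 12288 * (8 * z) ^ 3 := by gcongr
      _ = 6291456 * z ^ 3 := by ring
      _ ≤ 2 ^ 24 * z ^ 4 := by
          have : z ^ 3 ≤ z ^ 4 := pow_le_pow_right₀ hz1 (by norm_num)
          have : 0 ≤ z ^ 4 := by positivity
          linarith
      _ ≤ 2 ^ 24 * D := by rw [hz4]; gcongr
      _ ≤ 2 ^ 24 * (D * L * ℓ ^ 2) := by
          have : (D : ℝ) * 1 * 1 ^ 2 ≤ D * L * ℓ ^ 2 := by gcongr
          linarith
      _ ≤ T := hA

/-! ### A long iteration -/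

lemma timeBound_ge (n D : ℕ) : log n ^ 2 ≤ timeBound n D := by
  have h := one_le_log (n / D)
  have : 0 ≤ D * log (n / D) * log (log (n / D)) ^ 2 := by positivity
  unfold timeBound
  linarith

lemma width_le_card {V : Type} [Fintype V] (G : Digraph V) (w : ℕ → V) (d i : ℕ) :
    width G w d i ≤ Fintype.card V := by
  simpa using sum_width_le G w d {i}

/-- In a sufficiently long iteration, every node becomes active with high probability. -/
lemma expect_missProb_protocols_le {V : Type} [Fintype V] {G : Digraph V} {w : ℕ → V} {d D : ℕ}
    (hd : d ≤ D) (hw : ∀ i < d, G.Adj (w i) (w (i + 1))) {T : ℕ}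
    (hT : 2 ^ 24 * timeBound (Fintype.card V) D ≤ T) :
    (expect (samples (Framework.entry (protocols 1) T) T) fun l =>
        missProb (protocols 1) T G (w d) l {w 0}) ≤
      ENNReal.ofReal (Real.exp (-(2 * log (Fintype.card V)))) := by
  set n := Fintype.card V with hn
  have hn1 : 1 ≤ n := Fintype.card_pos_iff.2 ⟨w 0⟩
  have hx1 := one_le_log n
  have hTx : 2 ^ 24 * log n ^ 2 ≤ T := by
    have := timeBound_ge n D
    linarith
  have hsq : 4096 * log n ≤ √T := Real.le_sqrt_of_sq_le (by nlinarith)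
  have hT0 : (0 : ℝ) < T := by nlinarith
  -- For small `D` the exponent is `d - √T / 32 ≤ -√T / 64`, and `√T ≥ 4096 * log n`. For large `D`,
  -- General-Broadcast takes over.
  rcases le_or_gt (D : ℝ) (√T / 64) with h | h
  · set q : ℝ := 1 / (16 * √T) with hq
    have hs1 : 1 ≤ √(T : ℝ) := by linarith
    have hr : 0 < q / 2 := by positivity
    refine (expect_missProb_le_exp (q := fun _ => q) (r := q / 2) hr ?_ (fun _ _ => by linarith) hw
      (fun i _ N hN hNc => shallow_le_hitProb N hN ?_) T).trans (ENNReal.ofReal_le_ofReal ?_)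
    · rw [hq, div_div, div_le_one (by positivity)]
      linarith
    · have h1 : N.card ≤ n := hNc.trans (width_le_card G w d i)
      have h2 : (bits N.card : ℝ) ≤ bits n := by exact_mod_cast bits_mono h1
      have h3 := bits_le n
      linarith
    · refine Real.exp_le_exp.2 ?_
      have e1 : 2 * (q / 2) * ∑ i ∈ Finset.Icc 1 d, 1 / q = d := by
        rw [Finset.sum_const, Nat.card_Icc, nsmul_eq_mul, Nat.add_sub_cancel]
        have : q ≠ 0 := by linarith
        field_simp
      have e2 : q / 2 * T = √T / 32 := by
        rw [hq]
        nth_rewrite 2 [← Real.mul_self_sqrt hT0.le]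
        field_simp
        norm_num
      have e3 : (d : ℝ) ≤ D := by exact_mod_cast hd
      rw [e1, e2]
      linarith
  · have hD1 : 1 ≤ D := by
      have : (0 : ℝ) < D := lt_of_le_of_lt (by positivity) h
      exact_mod_cast this
    have hc1 := one_le_cost n
    have hcost : 8 * cost n * log n ≤ T := by
      have h1 := log_sq_mul_le_of_timeBound_le hn1 hT h
      have h2 := cost_le_mul_log n
      calc 8 * cost n * log n ≤ 8 * (384 * (log n * log (log n) ^ 2)) * log n := by gcongr
        _ = 3072 * (log n ^ 2 * log (log n) ^ 2) := by ring
        _ ≤ T := h1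
    have hsum : 4 * ∑ i ∈ Finset.Icc 1 d, cost (width G w d i) ≤ T := by
      have h1 := sum_cost_le hD1 hd (width G w d) (sum_width_le G w d _)
      have h2 : 2 ^ 24 * (D * log (n / D) * log (log (n / D)) ^ 2 + log n ^ 2) ≤ T := hT
      have h3 := one_le_log (n / D)
      have h4 : 0 ≤ D * log (n / D) * log (log (n / D)) ^ 2 := by positivity
      nlinarith
    -- The largest `r` for which widths up to `n` are sure to satisfy `2 * r ≤ q i`.
    set r : ℝ := 1 / (2 * cost n) with hr
    have hr0 : 0 < r := by positivity
    refine (expect_missProb_le_exp (q := fun i => 1 / cost (width G w d i)) (r := r) hr0 ?_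
      (fun i _ => ?_) hw (fun i _ N hN hNc => general_le_hitProb 1 T N hN hNc) T).trans
      (ENNReal.ofReal_le_ofReal ?_)
    · rw [hr, div_le_one (by positivity)]
      linarith
    · have h1 := one_le_cost (width G w d i)
      have h2 := cost_mono (width_le_card G w d i)
      calc 2 * r = 1 / cost n := by rw [hr]; field_simp
        _ ≤ _ := one_div_le_one_div_of_le (by linarith) h2
    · refine Real.exp_le_exp.2 ?_
      simp only [one_div_one_div]
      -- By `hsum` the positive part of the exponent is at most `r * T / 2`, so half of `r * T`
      -- remains.
      have h1 : 2 * log n ≤ r * T / 2 := by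
        rw [hr, div_mul_eq_mul_div, one_mul, div_div, le_div_iff₀ (by positivity)]
        linarith
      nlinarith

end RadioNetwork

end

/-! ### Choice of the iteration and union bound. -/

open RadioNetwork in
theorem mainTheorem1 :
    ∃ c₁ K c : ℝ, 0 < c₁ ∧ 0 < K ∧ 0 < c ∧ ∃ n₀ : ℕ,
      ∀ (M : Type) (m : M) (V : Type) [Fintype V] (G : Digraph V) (s : V),
        RadioNetwork.AllReachable G s → n₀ ≤ Fintype.card V →
        ∀ τ : ℕ,
          K * RadioNetwork.timeBound (Fintype.card V) (RadioNetwork.eccentricity G s) ≤ τ →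
          (RadioNetwork.broadcast c₁ M).failureProb G s m τ ≤
            ENNReal.ofReal ((Fintype.card V : ℝ) ^ (-c)) := by
  -- `2 ^ 26 = 4 * 2 ^ 24`, as the last complete iteration has length at least `τ / 4`.
  refine ⟨1, 2 ^ 26, 1, one_pos, by norm_num, one_pos, 0, ?_⟩
  intro M m V _ G s hreach _ τ hτ
  set n := Fintype.card V with hn
  set D := eccentricity G s with hD
  have hn1 : 1 ≤ n := Fintype.card_pos_iff.2 ⟨s⟩
  have hn0 : (0 : ℝ) < n := by exact_mod_cast hn1
  have hτ2 : 2 ≤ τ := by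
    have h1 := timeBound_ge n D
    have h2 : 1 ≤ log n ^ 2 := one_le_pow₀ (one_le_log n)
    have : (2 : ℝ) ≤ τ := by linarith
    exact_mod_cast this
  -- Iteration `t + 1` ends at time `2 ^ (t + 2) - 2` and is the last one completed by time `τ`.
  obtain ⟨t, ht⟩ : ∃ t, Nat.log 2 (τ + 2) = t + 2 := by
    refine Nat.exists_eq_add_of_le' ?_
    exact Nat.le_log_of_pow_le (by norm_num) (by omega)
  have ht1 : 2 ^ (t + 2) ≤ τ + 2 := ht ▸ Nat.pow_log_le_self 2 (by omega)
  have ht2 : τ + 2 < 2 ^ (t + 2 + 1) := ht ▸ Nat.lt_pow_succ_log_self (by norm_num) _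
  have hT : 2 ^ 24 * timeBound n D ≤ (2 ^ (t + 1) : ℕ) := by
    have : τ ≤ 4 * 2 ^ (t + 1) := by
      have : 2 ^ (t + 2 + 1) = 4 * 2 ^ (t + 1) := by ring
      omega
    have : (τ : ℝ) ≤ 4 * (2 ^ (t + 1) : ℕ) := by exact_mod_cast this
    linarith
  calc (broadcast 1 M).failureProb G s m τ
      ≤ (broadcast 1 M).failureProb G s m (2 ^ (t + 2) - 2) :=
        Framework.failureProb_antitone _ G s m (by omega)
    _ ≤ ∑ v, expect (samples (Framework.entry (protocols 1) (2 ^ (t + 1))) (2 ^ (t + 1)))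
          fun l => missProb (protocols 1) (2 ^ (t + 1)) G v l {s} :=
        Framework.failureProb_le_sum (protocols 1) G s m t
    _ ≤ ∑ v : V, ENNReal.ofReal (Real.exp (-(2 * log n))) := by
        refine Finset.sum_le_sum fun v _ => ?_
        -- Reachability rules out the default value `0` of `sInf` on the empty set.
        have hmem : Steps G (RadioNetwork.dist G s v) s v := Nat.sInf_mem (hreach v)
        obtain ⟨w, h0, hv, hw⟩ := Steps.exists_walk hmem
        have hd : RadioNetwork.dist G s v ≤ D :=
          Finset.le_sup (f := fun v => RadioNetwork.dist G s v) (Finset.mem_univ v)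
        have := expect_missProb_protocols_le hd hw hT
        rwa [h0, hv] at this
    _ ≤ ENNReal.ofReal ((n : ℝ) ^ (-1 : ℝ)) := by
        rw [Finset.sum_const, Finset.card_univ, nsmul_eq_mul, ← ENNReal.ofReal_natCast,
          ← ENNReal.ofReal_mul (by positivity)]
        refine ENNReal.ofReal_le_ofReal ?_
        -- Natural against binary logarithm: each node fails with probability at most `n⁻²`, and `n`
        -- nodes give `n⁻¹`.
        have hlog : Real.log n ≤ log n := by
          refine le_trans ?_ (le_max_left _ _)
          rw [Real.logb, le_div_iff₀ (Real.log_pos (by norm_num))]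
          have h1 : Real.log 2 ≤ 1 := by have := Real.log_two_lt_d9; linarith
          have h2 : 0 ≤ Real.log n := Real.log_natCast_nonneg n
          nlinarith
        calc (n : ℝ) * Real.exp (-(2 * log n)) ≤ n * Real.exp (-(2 * Real.log n)) := by gcongr
          _ = n * (Real.exp (Real.log n))⁻¹ ^ 2 := by
              rw [← Real.exp_neg, ← Real.exp_nat_mul]
              congr 2
              push_cast
              ring
          _ = (n : ℝ) ^ (-1 : ℝ) := by
              rw [Real.exp_log hn0, Real.rpow_neg_one]
              field_simp
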